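/- **Notation.** $[n]=\sum_{i=0}^{n-1}q^i$ and $[2m]!!=\prod_{i=1}^m[2i]$. A *ballot path* of length $(2n,n')$ is a lattice path from $(0,0)$ with $n+n'$ up steps $U=(1,1)$ and $n$ down steps $D=(1,-1)$ that never goes below $y=0$. Let $\lambda$ be a ballot path with $L$ steps in total. **Tilings.** For a ballot path $\mu$ with $L$ steps lying weakly above $\lambda$, the shifted skew shape $\lambda/\mu$ consists of the boxes (squares with vertices $(x\pm1,y)$, $(x,y\pm1)$) with center $(x,y)$, $1\le x\le L$, that lie between $\lambda$ and $\mu$, the paths being regarded as cutting the boxes with $x=L$ in half; the latter are the *anchor boxes*. A *ballot tile* of length $(2n,n')$ is a set of boxes whose centers form a translate of (the lattice points of) a ballot path of length $(2n,n')$; it is a *Dyck tile* if $n'=0$. A *cover-inclusive ballot tiling of type BI* of $\lambda/\mu$ is a partition of its boxes into ballot tiles such that 1. each tile with $n'\ge1$ has its rightmost box on an anchor box; 2. each tile, translated downward by one box, is either strictly below $\lambda$ or contained in another tile; 3. for all $n$ and all odd $n'$ the number of tiles of length $(2n,n')$ is even, and there are no tiles of length $(2n,n')$ with $n'$ even and positive.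 The statistic $\mathrm{art}$ of a tile of length $(2n,n')$ is $(2n+1+n'+\epsilon)/2$, where $\epsilon=1$ if $n'=0$ and $\epsilon=0$ otherwise; $\mathrm{art}(B)$ is the sum over the tiles of $B$. Put $$P^I_{\lambda,*}=\sum_\mu\sum_{B}q^{\mathrm{art}(B)},$$ where $\mu$ runs over the ballot paths with $L$ steps weakly above $\lambda$, and $B$ over the cover-inclusive ballot tilings of type BI of $\lambda/\mu$. **Tree.** Pair the $U$'s and $D$'s of $\lambda$ as parentheses, so that $\lambda=z_kUz_{k-1}U\cdots Uz_1Uz_0$ with Dyck words $z_i$ and $k$ unpaired $U$'s, which we number $1,\dots,k$ from right to left. The rooted plane tree $A(\lambda)$, some of whose edges carry a dot, is built as follows. For a Dyck word, $A(\emptyset)$ has no edges, $A(UzD)$ is $A(z)$ with a new undotted edge attached above its root, and $A(zz')$ is obtained by gluing $A(z)$ (on the left) and $A(z')$ at their roots. For $\lambda$, start with $A(z_0)$ and, for $i=1,\dots,k$ in turn, attach a new dotted edge above the root if $i$ is odd (leave the tree unchanged if $i$ is even), and then glue $A(z_i)$ to the left at the root. For odd $i$, each edge at the root of this copy of $A(z_i)$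 receives an arrow coming from the next edge to its right; there are no other arrows. So $A(\lambda)$ has no arrows if and only if $z_i=\emptyset$ for all odd $i\le k$. For an edge $e$ let $d(e)$ be the number of edges below $e$ (its descendants, $e$ excluded), and put $l(e)=d(e)+1$ if $e$ has no dot and $l(e)=2(d(e)+1)$ if $e$ has a dot. **Theorem.** Let $\lambda$ be a ballot path whose tree $A(\lambda)$ has no arrows, and let $N$ be the number of edges of $A(\lambda)$. Then $$P^I_{\lambda,*}=\frac{[2N]!!}{\prod_{e\in A(\lambda)}[l(e)]}.$$ -/

import Mathlib

open Polynomial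

namespace BallotBI

/-! ### Quantum integers -/

/-- The quantum integer `[n] = 1 + q + ⋯ + q^(n-1)`, with `q` the polynomial variable. -/
noncomputable def qInt (n : ℕ) : ℤ[X] := ∑ i ∈ Finset.range n, X ^ i

/-- `[2m]!! = [2][4]⋯[2m]`. -/
noncomputable def qEvenDoubleFactorial (m : ℕ) : ℤ[X] := ∏ i ∈ Finset.Icc 1 m, qInt (2 * i)

/-! ### Ballot paths -/

/-- A ballot path, written as its word of up and down steps: no prefix has more `D` than `U`. -/
def IsBallot (w : List DyckStep) : Prop :=
  ∀ i, (w.take i).count DyckStep.D ≤ (w.take i).count DyckStep.U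

/-- The ordinate of the path `w` at abscissa `x`; the path starts at the origin. -/
def height (w : List DyckStep) (x : ℕ) : ℤ :=
  ((w.take x).count DyckStep.U : ℤ) - ((w.take x).count DyckStep.D : ℤ)

/-- All words in `U`, `D` of length `n`. -/
def words : ℕ → Finset (List DyckStep)
  | 0 => {[]}
  | n + 1 => (words n).image (DyckStep.U :: ·) ∪ (words n).image (DyckStep.D :: ·)

/-- `mu` lies weakly above `lam`. -/
def IsAbove (mu lam : List DyckStep) : Prop := ∀ x, height lam x ≤ height mu x

open Classical in
/-- The ballot paths of the same length as `lam` lying weakly above `lam`. -/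
noncomputable def upperPaths (lam : List DyckStep) : Finset (List DyckStep) :=
  (words lam.length).filter fun mu => IsBallot mu ∧ IsAbove mu lam

/-! ### Ballot tilings of type BI

A box is a square with vertices `(x ± 1, y)` and `(x, y ± 1)`; it is represented by its
center `(x, y)`. -/

/-- The boxes of the shifted skew shape `lam / mu`: those between the lower path `lam` and the
upper path `mu`, with center at an abscissa `1 ≤ x ≤ N`, where `N` is the length of `lam`.
The boxes with `x = N` are the anchor boxes. -/
noncomputable def skewShape (lam mu : List DyckStep) : Finset (ℕ × ℤ) :=
  (Finset.Icc 1 lam.length).biUnion fun x =>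
    ((Finset.Ioo (height lam x) (height mu x)).filter fun y => Odd (y - height lam x)).image
      fun y => (x, y)

/-- `t` is the set of boxes of a ballot tile of length `(2n, n')`: the centers of its boxes are
the lattice points of a translate of a ballot path with `n + n'` up and `n` down steps.
A Dyck tile is a ballot tile of length `(2n, 0)`. -/
def IsTile (n n' : ℕ) (t : Finset (ℕ × ℤ)) : Prop :=
  ∃ w : List DyckStep, IsBallot w ∧ w.count DyckStep.U = n + n' ∧ w.count DyckStep.D = n ∧
    ∃ (a : ℕ) (b : ℤ),
      t = (Finset.range (2 * n + n' + 1)).image fun i => (a + i, b + height w i)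

/-- The translate of a box downward by one box: the box immediately below it. -/
def boxBelow (b : ℕ × ℤ) : ℕ × ℤ := (b.1, b.2 - 2)

open Classical in
/-- `T`, a partition into nonempty sets of the boxes of `lam / mu`, is a cover-inclusive ballot
tiling of type BI. -/
structure IsTilingBI (lam mu : List DyckStep) (T : Finpartition (skewShape lam mu)) : Prop where
  /-- Every part is a ballot tile. -/
  tile : ∀ t ∈ T.parts, ∃ n n', IsTile n n' t
  /-- Every ballot tile that is not a Dyck tile ends on an anchor box. -/
  anchored : ∀ t ∈ T.parts, ∀ n n', 1 ≤ n' → IsTile n n' t → ∃ b ∈ t, b.1 = lam.length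
  /-- The downward translate of a tile is strictly below `lam` or contained in another tile. -/
  cover_inclusive : ∀ t ∈ T.parts,
    (∀ b ∈ t, (boxBelow b).2 < height lam b.1) ∨ ∃ t' ∈ T.parts, t.image boxBelow ⊆ t'
  /-- For each length `(2n, n')` with `n'` odd, the number of tiles of this length is even. -/
  even_of_odd : ∀ n n', Odd n' → Even (T.parts.filter (IsTile n n')).card
  /-- There is no tile of length `(2n, n')` with `n'` even and positive. -/
  none_of_even : ∀ n n', Even n' → 0 < n' → ∀ t ∈ T.parts, ¬ IsTile n n' t

open Classical in
/-- The statistic `art = (area + tiles) / 2` of a tile. Here `area` is the number of boxes, which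
is `2n + 1 + n'` for a tile of length `(2n, n')`, and `tiles` is `1` for a Dyck tile and `0`
otherwise. For the tiles of a tiling of type BI the sum is even. -/
noncomputable def tileArt (t : Finset (ℕ × ℤ)) : ℕ :=
  (t.card + if ∃ n, IsTile n 0 t then 1 else 0) / 2

/-- The statistic `art` of a tiling, the sum over its tiles. -/
noncomputable def art {s : Finset (ℕ × ℤ)} (T : Finpartition s) : ℕ := ∑ t ∈ T.parts, tileArt t

open Classical in
/-- The generating function `P^I_{lam, mu}` of the cover-inclusive ballot tilings of type BI. -/
noncomputable def genFunBI (lam mu : List DyckStep) : ℤ[X] :=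
  ∑ T : Finpartition (skewShape lam mu) with IsTilingBI lam mu T, X ^ art T

/-- The generating function `P^I_{lam, *}`: the sum of `P^I_{lam, mu}` over all upper paths. -/
noncomputable def genFunBILower (lam : List DyckStep) : ℤ[X] :=
  ∑ mu ∈ upperPaths lam, genFunBI lam mu

/-! ### The plane tree of a ballot path -/

/-- Rooted plane trees with marked edges. `root` is the tree without edges.
`edge dot arrow below right` is the tree whose leftmost edge at the root carries a dot iff `dot`,
has an incoming arrow (which comes from the next edge to its right at the same vertex) iff
`arrow`, and has the tree `below` hanging at its lower end, and whose further edges at the root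
form, together with what is below them, the tree `right`. -/
inductive MarkedTree : Type
  | root : MarkedTree
  | edge (dot arrow : Bool) (below right : MarkedTree) : MarkedTree

namespace MarkedTree

/-- The number of edges. -/
def size : MarkedTree → ℕ
  | root => 0
  | edge _ _ below right => below.size + 1 + right.size

/-- The tree has no arrows. -/
def NoArrows : MarkedTree → Prop
  | root => True
  | edge _ arrow below right => arrow = false ∧ below.NoArrows ∧ right.NoArrows

/-- The list of the `l(e)`, for `e` running over all edges. The descendants of an edge are the
edges of the tree below it; `l(e)` is one plus their number if `e` has no dot, and twice this
if `e` has a dot. -/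
def hookLengths : MarkedTree → List ℕ
  | root => []
  | edge dot _ below right =>
      (if dot then 2 * below.size + 2 else below.size + 1) ::
        (below.hookLengths ++ right.hookLengths)

end MarkedTree

/-- Splits a word as `z D w'` at the first `D` whose partner is not in the word and which is
preceded by `d` other such `D`s. So `splitAtPartner 0 w = some (z, w')` if in the word `U w` the
first `U` is paired with a `D` and `U w = U z D w'` for this pair, where `z` is a Dyck word. The
result is `none` if this `U` is unpaired. -/
def splitAtPartner : ℕ → List DyckStep → Option (List DyckStep × List DyckStep)
  | _, [] => none
  | 0, DyckStep.D :: w => some ([], w)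
  | d + 1, DyckStep.D :: w => (splitAtPartner d w).map fun p => (DyckStep.D :: p.1, p.2)
  | d, DyckStep.U :: w => (splitAtPartner (d + 1) w).map fun p => (DyckStep.U :: p.1, p.2)

theorem splitAtPartner_eq {d : ℕ} {w z w' : List DyckStep}
    (h : splitAtPartner d w = some (z, w')) : w = z ++ DyckStep.D :: w' := by
  induction w generalizing d z with
  | nil => simp [splitAtPartner] at h
  | cons s w ih =>
    cases s with
    | U =>
      simp only [splitAtPartner, Option.map_eq_some_iff] at h
      obtain ⟨⟨p, r⟩, hp, he⟩ := h
      simp only [Prod.mk.injEq] at he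
      obtain ⟨rfl, rfl⟩ := he
      simp [ih hp]
    | D =>
      cases d with
      | zero =>
        simp only [splitAtPartner, Option.some.injEq, Prod.mk.injEq] at h
        obtain ⟨rfl, rfl⟩ := h
        rfl
      | succ d =>
        simp only [splitAtPartner, Option.map_eq_some_iff] at h
        obtain ⟨⟨p, r⟩, hp, he⟩ := h
        simp only [Prod.mk.injEq] at he
        obtain ⟨rfl, rfl⟩ := he
        simp [ih hp]

/-- The number of unpaired `U`s of a ballot path. -/
def unpairedU (w : List DyckStep) : ℕ := w.count DyckStep.U - w.count DyckStep.D

/-- The marked plane tree `A(w)` of a ballot path `w`. Number the unpaired `U`s of the path from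
right to left by `1, 2, 3, …`. The first is the terminal `U`, the ones numbered `2r + 1` and `2r`
for `r ≥ 1` form a `UU`-pair, and the leftmost one is an extra `U` if it has an even number.

* A pair `U z D` followed by `w'` contributes an edge without dot just above `A(z)`, to the left
  of `A(w')`. This edge has an incoming arrow iff the number of unpaired `U`s in `w'` is odd, that
  is, iff `U z D` belongs to the maximal Dyck word which ends just before a terminal `U` or
  before the left `U` of a `UU`-pair.
* A terminal `U`, and the left `U` of a `UU`-pair, followed by `w`, contributes a dotted edge
  above `A(w)`; these are the unpaired `U`s with an odd number.
* The other unpaired `U`s do not contribute. -/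
def ballotTree : List DyckStep → MarkedTree
  | [] => .root
  | DyckStep.D :: w => ballotTree w
  | DyckStep.U :: w =>
    match _h : splitAtPartner 0 w with
    | some (z, w') => .edge false (decide (Odd (unpairedU w'))) (ballotTree z) (ballotTree w')
    | none => if Even (unpairedU w) then .edge true false (ballotTree w) .root else ballotTree w
termination_by w => w.length
decreasing_by
  all_goals first
    | (have := congrArg List.length (splitAtPartner_eq _h); simp at this ⊢; omega)
    | simp

end BallotBI

/-! Count the boxes of each column upwards from `λ`, so that the boxes of equal rank form rows
parallel to `λ`. Cover-inclusiveness lets every tile be pushed down step by step until it rests on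
`λ`. Therefore a tile stays in one row (`box_eq_of_linked`), and two neighbours in a row that share
a tile force the same in all lower rows (`linked_of_succ`). A tiling is thus encoded by two
functions: the number `m x` of boxes in column `x`, and the link number `l x`, the number of rows in
which one tile contains the boxes of columns `x` and `x + 1`. The tiles are the maximal runs of
linked boxes.

In this encoding the conditions become local. The runs are anchored ballot tiles iff a down step has
the link number of its partner and link numbers do not decrease from outer to inner steps
(`LinkOK`). Let `a₁, a₂, …` be the link numbers of the unpaired up steps, from right to left. When
there are no arrows, the parity conditions on the tiles say that `a₁` is even, `a₂ = a₃` is even,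
`a₄ = a₅` is even, and so on, with `0` for a missing entry (`EndOK`). The statistic `art` becomes a
sum over the steps plus a boundary term (`art_eq_cfgStat`). This gives the bijection of
`genFunBILower_eq_gf`.

The generating function `gf` of these configurations is computed by a transfer argument, with the
number of boxes in the current column as the state. A pair `UD` acts by the operator `hop`, and a
Dyck word with `N` pairs acts, up to a power of `q`, by the `N`-th iterate of `hop` divided by the
hook product of its tree (`gf_dyck`). The induction rests on `nest_hop`: enclosing `hop^[N]` in a
pair and multiplying by `[N + 1]` gives `hop^[N + 1]`. By linearity it suffices to check this on
geometric sequences `y ^ j`. There the generating function of the iterates is an explicit product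
(`kernel_formula`), and the sum over the link numbers of the outer pair is a geometric series that
supplies the one missing factor of the denominator.

Without arrows, every unpaired up step with an even number is immediately followed by the next
unpaired one. By `unpaired_hop` such a block `UU` turns `hop^[N] 1` into `hop^[N + 1] 1` divided by
`[2 (N + 1)]`; the evenness of a link number is what doubles the hook length. What remains is the
value of `hop^[N] 1` at `0`, which is `[2N]!!`. -/

namespace BallotBI

/-! ### The transfer operator and its linearity. -/

section Hop

variable {M M' : Type*} [AddCommGroup M] [Module ℤ[X] M] [AddCommGroup M'] [Module ℤ[X] M']

/-- The transfer operator of a pair `UD`. -/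
noncomputable def hop (f : ℕ → M) : ℕ → M := fun i =>
  ((X : ℤ[X]) ^ i * (qInt i + qInt (i + 1))) • f i + ((X : ℤ[X]) ^ (i + 1) * qInt (i + 1)) • f (i + 1)
    + ((X : ℤ[X]) ^ (i - 1) * qInt i) • f (i - 1)

theorem hop_comp (φ : M →ₗ[ℤ[X]] M') (f : ℕ → M) : hop (φ ∘ f) = φ ∘ hop f := by
  funext i
  simp [hop]

/-- This is what carries identities for geometric sequences over to arbitrary sequences. -/
theorem hop_iterate_comp (φ : M →ₗ[ℤ[X]] M') (N : ℕ) (f : ℕ → M) :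
    hop^[N] (φ ∘ f) = φ ∘ hop^[N] f := by
  induction N generalizing f with
  | zero => rfl
  | succ N ih => simp only [Function.iterate_succ_apply, hop_comp, ih]

end Hop

/-! ### Quantum integers. -/

theorem sub_one_mul_qInt (n : ℕ) : (X - 1 : ℤ[X]) * qInt n = X ^ n - 1 := by
  rw [qInt, mul_comm, geom_sum_mul]

theorem qInt_ne_zero {n : ℕ} (hn : n ≠ 0) : qInt n ≠ 0 := by
  intro h
  have := congrArg (Polynomial.eval 1) h
  simp [qInt, Polynomial.eval_finsetSum] at this
  exact hn this

theorem qInt_two_mul (n : ℕ) : qInt (2 * n) = qInt n * (1 + X ^ n) := by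
  have h : (X - 1 : ℤ[X]) ≠ 0 := X_sub_C_ne_zero 1
  apply mul_left_cancel₀ h
  rw [sub_one_mul_qInt, ← mul_assoc, sub_one_mul_qInt]
  ring

/-! ### The generating function of the iterates of `hop` on a geometric sequence. -/

section Kernel

open PowerSeries (mk rescale coeff_mk coeff_rescale coeff_succ_X_mul coeff_succ_mul_X)

variable {S : Type*} [CommRing S]

theorem rescale_C (c r : S) : rescale c (PowerSeries.C r) = PowerSeries.C r := by
  ext n
  simp only [coeff_rescale, PowerSeries.coeff_C]
  split_ifs with h <;> simp [h]

theorem constantCoeff_rescale (c : S) (f : PowerSeries S) :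
    PowerSeries.constantCoeff (rescale c f) = PowerSeries.constantCoeff f := by
  rw [← PowerSeries.coeff_zero_eq_constantCoeff_apply, coeff_rescale, pow_zero, one_mul,
    PowerSeries.coeff_zero_eq_constantCoeff_apply]

theorem rescale_linear (c r : S) :
    rescale c (PowerSeries.C r * PowerSeries.X) = PowerSeries.C (c * r) * PowerSeries.X := by
  rw [map_mul, rescale_C, PowerSeries.rescale_X, map_mul]
  ring

variable [Algebra ℤ[X] S]

/-- The quantum parameter in an algebra over `ℤ[X]`. -/
noncomputable def qq (S : Type*) [CommRing S] [Algebra ℤ[X] S] : S :=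
  algebraMap ℤ[X] S Polynomial.X

theorem qq_sub_one_mul (n : ℕ) : (qq S - 1) * algebraMap ℤ[X] S (qInt n) = qq S ^ n - 1 := by
  have := congrArg (algebraMap ℤ[X] S) (sub_one_mul_qInt n)
  simpa [qq] using this

/-- Multiplication by `q - 1` turns the quantum integers into `q ^ k - 1`. The coefficients of `hop`
are then combinations of `q ^ i` and `q ^ (2 i)` up to shifts, and on generating functions these
powers are the substitutions `x ↦ q x` and `x ↦ q² x`. -/
theorem hop_functional_equation (a : ℕ → S) :
    PowerSeries.C (qq S - 1) * (PowerSeries.X * mk (hop a)) =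
      (1 + PowerSeries.X) * ((1 + PowerSeries.C (qq S) * PowerSeries.X) * rescale (qq S ^ 2) (mk a)
        - (1 + PowerSeries.X) * rescale (qq S) (mk a)) := by
  have e : (1 + PowerSeries.X) * ((1 + PowerSeries.C (qq S) * PowerSeries.X) * rescale (qq S ^ 2) (mk a)
        - (1 + PowerSeries.X) * rescale (qq S) (mk a)) =
      rescale (qq S ^ 2) (mk a)
        + PowerSeries.X * rescale (qq S ^ 2) (mk a)
        + PowerSeries.X * (PowerSeries.C (qq S) * rescale (qq S ^ 2) (mk a))
        + PowerSeries.X * (PowerSeries.X * (PowerSeries.C (qq S) * rescale (qq S ^ 2) (mk a)))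
        - rescale (qq S) (mk a) - PowerSeries.X * (PowerSeries.C 2 * rescale (qq S) (mk a))
        - PowerSeries.X * (PowerSeries.X * (rescale (qq S) (mk a))) := by
    simp only [map_ofNat]
    ring
  rw [e]
  ext n
  have hq : ∀ k, algebraMap ℤ[X] S ((Polynomial.X : ℤ[X]) ^ k) = qq S ^ k := by simp [qq]
  rcases n with _ | _ | n
  · simp [constantCoeff_rescale]
  · have h1 := qq_sub_one_mul (S := S) 1
    simp [coeff_succ_X_mul, hop, Algebra.smul_def, -map_sub]
    simp [qInt, qq]
    ring
  · have h1 := qq_sub_one_mul (S := S) (n + 1)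
    have h2 := qq_sub_one_mul (S := S) (n + 2)
    simp only [PowerSeries.coeff_C_mul, coeff_succ_X_mul, LinearMap.map_sub, coeff_rescale, coeff_mk, hop,
      Algebra.smul_def, map_add, map_mul, hq, Nat.add_sub_cancel]
    linear_combination (qq S ^ (n + 1) * a (n + 1) + qq S ^ n * a n) * h1 +
      (qq S ^ (n + 1) * a (n + 1) + qq S ^ (n + 2) * a (n + 2)) * h2

/-- `(1 + x)(1 + q x) ⋯ (1 + q^(N-1) x)`. -/
noncomputable def numer (S : Type*) [CommRing S] [Algebra ℤ[X] S] (N : ℕ) : PowerSeries S :=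
  ∏ k ∈ Finset.range N, (1 + PowerSeries.C (qq S ^ k) * PowerSeries.X)

/-- `(1 - q^a y x) ⋯ (1 - q^(a+n-1) y x)`. -/
noncomputable def denom (y : S) (a n : ℕ) : PowerSeries S :=
  ∏ k ∈ Finset.range n, (1 - PowerSeries.C (qq S ^ (a + k) * y) * PowerSeries.X)

/-- `[N]! (1 + q y) ⋯ (1 + q^N y)`. -/
noncomputable def kernelConst (y : S) (N : ℕ) : S :=
  ∏ k ∈ Finset.range N, (algebraMap ℤ[X] S (qInt (k + 1)) * (1 + qq S ^ (k + 1) * y))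

theorem numer_succ' (N : ℕ) : numer S (N + 1) = (1 + PowerSeries.X) * rescale (qq S) (numer S N) := by
  rw [numer, Finset.prod_range_succ', mul_comm, numer, map_prod]
  simp only [map_add, map_one, rescale_linear, pow_zero, one_mul, pow_succ']

theorem numer_succ (N : ℕ) : numer S (N + 1) = numer S N * (1 + PowerSeries.C (qq S ^ N) * PowerSeries.X) :=
  Finset.prod_range_succ _ _

theorem rescale_denom (y : S) (a n : ℕ) : rescale (qq S) (denom y a n) = denom y (a + 1) n := by
  rw [denom, denom, map_prod]
  refine Finset.prod_congr rfl fun k _ => ?_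
  rw [map_sub, map_one, rescale_linear]
  congr 3
  ring

theorem denom_succ (y : S) (a n : ℕ) :
    denom y a (n + 1) = denom y a n * (1 - PowerSeries.C (qq S ^ (a + n) * y) * PowerSeries.X) :=
  Finset.prod_range_succ _ _

theorem denom_succ' (y : S) (a n : ℕ) :
    denom y a (n + 1) = (1 - PowerSeries.C (qq S ^ a * y) * PowerSeries.X) * denom y (a + 1) n := by
  rw [denom, Finset.prod_range_succ', mul_comm, denom]
  congr 1
  refine Finset.prod_congr rfl fun k _ => ?_
  congr 4
  ring

theorem denom_mul_q (y : S) (a n : ℕ) : denom (qq S * y) a n = denom y (a + 1) n := by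
  refine Finset.prod_congr rfl fun k _ => ?_
  congr 3
  ring

theorem rescale_sq (f : PowerSeries S) : rescale (qq S ^ 2) f = rescale (qq S) (rescale (qq S) f) := by
  ext n
  simp only [coeff_rescale]
  ring

theorem constantCoeff_denom (y : S) (a n : ℕ) : PowerSeries.constantCoeff (denom y a n) = 1 := by
  simp [denom, map_prod]

variable [IsDomain S]

theorem denom_ne_zero (y : S) (a n : ℕ) : denom y a n ≠ 0 := by
  intro h
  have := constantCoeff_denom y a n
  simp [h] at this

/-- Induction on `N` through the functional equation. Over a common denominator the bracket
collapses, because `(1 + Q x)(1 - Q y x) - (1 + x)(1 - Q² y x) = (Q - 1)(1 + Q y) x` for `Q = q ^ (N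
+ 1)`. After division by `(q - 1) x` this is exactly the new factor of `kernelConst`. -/
theorem kernel_formula (hq : qq S ≠ 1) (y : S) (N : ℕ) :
    mk (hop^[N] fun j => y ^ j) * denom y N (N + 1) = PowerSeries.C (kernelConst y N) * numer S N := by
  induction N with
  | zero =>
    have : (mk fun j => y ^ j) * (1 - PowerSeries.C y * PowerSeries.X) = 1 := by
      ext n
      rw [mul_sub, mul_one, ← mul_assoc, mul_comm _ (PowerSeries.C y), mul_assoc, map_sub, PowerSeries.coeff_C_mul]
      rcases n with _ | n
      · simp
      · simp [coeff_succ_mul_X, PowerSeries.coeff_one]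
        ring
    simpa [denom, kernelConst, numer] using this
  | succ N ih =>
    set K := mk (hop^[N] fun j => y ^ j) with hK
    have hf := hop_functional_equation (S := S) (hop^[N] fun j => y ^ j)
    rw [← Function.iterate_succ_apply' hop, ← hK] at hf
    have h0 : (PowerSeries.C (qq S - 1) * PowerSeries.X : PowerSeries S) ≠ 0 :=
      mul_ne_zero (by rw [Ne, map_eq_zero_iff _ PowerSeries.C_injective]; exact sub_ne_zero.2 hq) PowerSeries.X_ne_zero
    apply mul_left_cancel₀ h0
    have i1 := congrArg (rescale (qq S)) ih
    rw [map_mul, map_mul, rescale_denom, rescale_C] at i1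
    have i2 := congrArg (rescale (qq S)) i1
    rw [map_mul, map_mul, rescale_denom, rescale_C] at i2
    rw [← rescale_sq] at i2
    have n1 := numer_succ' (S := S) N
    -- Two expressions for `numer S (N + 2)`: its first two factors split off, or its last one.
    have n2 := numer_succ (S := S) (N + 1)
    rw [numer_succ' (N + 1), n1, map_mul, map_add, map_one, PowerSeries.rescale_X] at n2
    have d1 := denom_succ y (N + 1) (N + 1)
    have d2 := denom_succ' y (N + 1) (N + 1)
    have hc : PowerSeries.C (kernelConst y (N + 1)) * PowerSeries.C (qq S - 1) =
        PowerSeries.C (kernelConst y N) * PowerSeries.C (qq S ^ (N + 1) - 1) * PowerSeries.C (1 + qq S ^ (N + 1) * y) := by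
      rw [← map_mul, ← map_mul, ← map_mul, kernelConst, Finset.prod_range_succ, ← kernelConst,
        ← qq_sub_one_mul]
      congr 1; ring
    have e1 : PowerSeries.C (qq S - 1) * PowerSeries.X * (mk (hop^[N + 1] fun j => y ^ j)
          * denom y (N + 1) (N + 1 + 1)) =
        (1 + PowerSeries.X) * ((1 + PowerSeries.C (qq S) * PowerSeries.X) * ((rescale (qq S ^ 2)) K * denom y (N + 1 + 1) (N + 1)
          * (1 - PowerSeries.C (qq S ^ (N + 1) * y) * PowerSeries.X))
        - (1 + PowerSeries.X) * ((rescale (qq S)) K * denom y (N + 1) (N + 1) *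
          (1 - PowerSeries.C (qq S ^ (N + 1 + (N + 1)) * y) * PowerSeries.X))) := by
      linear_combination (denom y (N + 1) (N + 1 + 1)) * hf +
        (1 + PowerSeries.X) * (1 + PowerSeries.C (qq S) * PowerSeries.X) * (rescale (qq S ^ 2)) K * d2
        - (1 + PowerSeries.X) * (1 + PowerSeries.X) * (rescale (qq S)) K * d1
    rw [e1, i1, i2, n1]
    simp only [map_mul, map_pow, map_sub, map_add, map_one] at hc n2 ⊢
    linear_combination (-(1 + PowerSeries.X) * rescale (qq S) (numer S N) * PowerSeries.X) * hc +
      PowerSeries.C (kernelConst y N) * (1 - PowerSeries.C (qq S) ^ (N + 1) * PowerSeries.C y * PowerSeries.X) * n2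
end Kernel

/-- `prevSum f i = f i + f (i - 1)`, where the second term is omitted for `i = 0`. -/
def prevSum {M : Type*} [Add M] (f : ℕ → M) : ℕ → M
  | 0 => f 0
  | i + 1 => f (i + 1) + f i

theorem prevSum_add {M : Type*} [AddMonoid M] (f : ℕ → M) (c i : ℕ) (h : ∀ k < c, f k = 0) :
    prevSum f (c + i) = prevSum (fun k => f (c + k)) i := by
  rcases i with _ | i
  · rcases c with _ | c
    · rfl
    · simp [prevSum, h c (Nat.lt_succ_self c)]
  · rfl

/-! ### Enclosing in a pair, and two unpaired up steps, as operator identities. -/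

section

open PowerSeries (mk rescale coeff_mk coeff_rescale coeff_succ_X_mul coeff_succ_mul_X)

variable {S : Type*} [CommRing S]

theorem mk_prevSum (f : ℕ → S) : mk (prevSum f) = (1 + PowerSeries.X) * mk f := by
  ext n
  rw [add_mul, one_mul, map_add]
  rcases n with _ | n
  · simp [prevSum]
  · rw [coeff_succ_X_mul]
    simp [prevSum]

theorem geom_mul (y : S) : mk (fun j => y ^ j) * (1 - PowerSeries.C y * PowerSeries.X) = 1 := by
  ext n
  rw [mul_sub, mul_one, ← mul_assoc, mul_comm _ (PowerSeries.C y), mul_assoc, map_sub,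
    PowerSeries.coeff_C_mul]
  rcases n with _ | n
  · simp
  · simp [coeff_succ_mul_X, PowerSeries.coeff_one]
    ring

theorem even_geom_mul (y : S) :
    mk (fun j => if Even j then y ^ j else 0) *
      ((1 - PowerSeries.C y * PowerSeries.X) * (1 + PowerSeries.C y * PowerSeries.X)) = 1 := by
  have e : mk (fun j => if Even j then y ^ j else 0) *
      ((1 - PowerSeries.C y * PowerSeries.X) * (1 + PowerSeries.C y * PowerSeries.X)) =
      mk (fun j => if Even j then y ^ j else 0) - PowerSeries.C (y ^ 2) *
        (mk (fun j => if Even j then y ^ j else 0) * PowerSeries.X * PowerSeries.X) := by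
    rw [map_pow]; ring
  rw [e]
  ext n
  rw [map_sub, PowerSeries.coeff_C_mul]
  rcases n with _ | _ | n
  · simp
  · simp [coeff_succ_mul_X, PowerSeries.coeff_one]
  · rw [coeff_succ_mul_X, coeff_succ_mul_X]
    have : Even (n + 1 + 1) ↔ Even n := by simp [Nat.even_add_one]
    simp only [coeff_mk, PowerSeries.coeff_one, this, Nat.add_eq_zero_iff, one_ne_zero, and_false,
      if_false]
    split_ifs
    · ring
    · ring

theorem mk_mul_mk (f g : ℕ → S) :
    mk f * mk g = mk fun n => ∑ d ∈ Finset.range (n + 1), f d * g (n - d) := by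
  ext n
  rw [PowerSeries.coeff_mul, coeff_mk]
  simp only [coeff_mk]
  exact Finset.Nat.sum_antidiagonal_eq_sum_range_succ (fun a b => f a * g b) n

variable [Algebra ℤ[X] S]

theorem hop_iterate_mul (N : ℕ) (s : S) (f : ℕ → S) (i : ℕ) :
    hop^[N] (fun j => s * f j) i = s * hop^[N] f i :=
  congrFun (hop_iterate_comp (LinearMap.mulLeft ℤ[X] s) N f) i

theorem kernelConst_succ (y : S) (N : ℕ) :
    kernelConst y (N + 1) =
      algebraMap ℤ[X] S (qInt (N + 1)) * (1 + qq S * y) * kernelConst (qq S * y) N := by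
  simp only [kernelConst, Finset.prod_mul_distrib]
  rw [Finset.prod_range_succ, Finset.prod_range_succ' (fun k => 1 + qq S ^ (k + 1) * y)]
  have : ∀ k, 1 + qq S ^ (k + 1 + 1) * y = 1 + qq S ^ (k + 1) * (qq S * y) := fun k => by ring
  simp only [this]
  ring

variable [IsDomain S]

/-- The down step replaces `y` by `q y`, up to the factor `1 + q y`. The sum over the excess `d` of
the link number is a convolution with the geometric series `1 / (1 - q ^ (N + 1) y x)`, whose
denominator is the first factor of `denom y (N + 1) (N + 2)`; the rescaled kernel of `q y` has all
the others. -/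
theorem nest_power (hq : qq S ≠ 1) (y : S) (N i : ℕ) :
    algebraMap ℤ[X] S (qInt (N + 1)) * prevSum (fun i' => ∑ d ∈ Finset.range (i' + 1),
      (X : ℤ[X]) ^ (i' - d + d * N) • hop^[N] (fun j => (X : ℤ[X]) ^ (d + j) • y ^ (d + j)
        + (X : ℤ[X]) ^ (d + j + 1) • y ^ (d + j + 1)) (i' - d)) i =
      hop^[N + 1] (fun j => y ^ j) i := by
  set B := fun i' => ∑ d ∈ Finset.range (i' + 1),
      (X : ℤ[X]) ^ (i' - d + d * N) • hop^[N] (fun j => (X : ℤ[X]) ^ (d + j) • y ^ (d + j)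
        + (X : ℤ[X]) ^ (d + j + 1) • y ^ (d + j + 1)) (i' - d) with hB
  set a := hop^[N] (fun j => (qq S * y) ^ j) with ha
  have hsm : ∀ k (s : S), (X : ℤ[X]) ^ k • s = qq S ^ k * s := fun k s => by
    simp [Algebra.smul_def, qq]
  have e1 : mk B = PowerSeries.C (1 + qq S * y) *
      (mk (fun d => (qq S ^ (N + 1) * y) ^ d) * rescale (qq S) (mk a)) := by
    rw [PowerSeries.rescale_mk, mk_mul_mk]
    ext i'
    rw [PowerSeries.coeff_C_mul, coeff_mk, coeff_mk, hB, Finset.mul_sum]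
    refine Finset.sum_congr rfl fun d _ => ?_
    have : (fun j => (X : ℤ[X]) ^ (d + j) • y ^ (d + j)
        + (X : ℤ[X]) ^ (d + j + 1) • y ^ (d + j + 1)) =
        fun j => ((1 + qq S * y) * (qq S * y) ^ d) * (qq S * y) ^ j := by
      funext j
      simp only [hsm]
      ring
    rw [this, hop_iterate_mul, hsm]
    ring
  have k1 := congrArg (rescale (qq S)) (kernel_formula hq (qq S * y) N)
  rw [map_mul, map_mul, rescale_denom, rescale_C, denom_mul_q, ← ha] at k1
  have k2 := kernel_formula hq y (N + 1)
  rw [numer_succ', denom_succ', kernelConst_succ, map_mul (PowerSeries.C) _ (kernelConst _ _),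
    map_mul (PowerSeries.C) (algebraMap _ _ _)] at k2
  have g := geom_mul (qq S ^ (N + 1) * y)
  have h1 : (1 - PowerSeries.C (qq S ^ (N + 1) * y) * PowerSeries.X : PowerSeries S) ≠ 0 := by
    intro h
    rw [h, mul_zero] at g
    exact zero_ne_one g
  have key : PowerSeries.C (algebraMap ℤ[X] S (qInt (N + 1))) * mk (prevSum B) =
      mk (hop^[N + 1] fun j => y ^ j) := by
    apply mul_right_cancel₀ (mul_ne_zero h1 (denom_ne_zero y (N + 1 + 1) (N + 1)))
    rw [k2, mk_prevSum, e1]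
    linear_combination PowerSeries.C (algebraMap ℤ[X] S (qInt (N + 1))) *
      PowerSeries.C (1 + qq S * y) * (1 + PowerSeries.X) * k1 +
      PowerSeries.C (algebraMap ℤ[X] S (qInt (N + 1))) * (1 + PowerSeries.X) *
      PowerSeries.C (1 + qq S * y) * rescale (qq S) (mk a) * denom y (N + 1 + 1) (N + 1) * g
  have := congrArg (PowerSeries.coeff i) key
  rwa [PowerSeries.coeff_C_mul, coeff_mk, coeff_mk] at this

end

theorem qq_self : qq ℤ[X] = X := rfl

theorem X_ne_one' : (X : ℤ[X]) ≠ 1 := fun h => by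
  have := congrArg (Polynomial.eval 0) h
  simp at this

theorem qq_self_ne_one : qq ℤ[X] ≠ 1 := by
  rw [qq_self]
  exact X_ne_one'

theorem qq_polynomial_ne_one : qq ℤ[X][X] ≠ 1 := by
  intro h
  have h' : (C (X : ℤ[X]) : ℤ[X][X]) = C 1 := by simpa [qq] using h
  exact X_ne_one' (C_injective h')

/-- The effect of enclosing a Dyck word in a pair `UD`, in terms of the transfer operator. -/
theorem nest_hop (g : ℕ → ℤ[X]) (N i : ℕ) :
    qInt (N + 1) * prevSum (fun i' => ∑ d ∈ Finset.range (i' + 1),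
      X ^ (i' - d + d * N) * hop^[N] (fun j => X ^ (d + j) * g (d + j)
        + X ^ (d + j + 1) * g (d + j + 1)) (i' - d)) i = hop^[N + 1] g i := by
  -- The linear functional `X ^ j ↦ g j`. Applied to the identity for `y = X` it yields the one for
  -- `g`.
  let φ : ℤ[X][X] →ₗ[ℤ[X]] ℤ[X] :=
    Polynomial.lsum fun j => LinearMap.toSpanSingleton ℤ[X] ℤ[X] (g j)
  have hφ : ∀ j, φ (X ^ j) = g j := fun j => by
    simp [φ, X_pow_eq_monomial, Polynomial.sum_monomial_index]
  have h := congrArg φ (nest_power qq_polynomial_ne_one (X : ℤ[X][X]) N i)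
  have hc : φ ∘ (fun j => (X : ℤ[X][X]) ^ j) = g := funext hφ
  have e2 := congrFun (hop_iterate_comp φ (N + 1) (fun j => (X : ℤ[X][X]) ^ j)) i
  rw [hc, Function.comp_apply] at e2
  rw [← e2, ← Algebra.smul_def, map_smul, smul_eq_mul] at h
  rw [← h]
  congr 1
  have hB : ∀ i', φ (∑ d ∈ Finset.range (i' + 1),
      (X : ℤ[X]) ^ (i' - d + d * N) • hop^[N] (fun j => (X : ℤ[X]) ^ (d + j) • (X : ℤ[X][X]) ^ (d + j)
        + (X : ℤ[X]) ^ (d + j + 1) • (X : ℤ[X][X]) ^ (d + j + 1)) (i' - d)) =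
      ∑ d ∈ Finset.range (i' + 1),
      X ^ (i' - d + d * N) * hop^[N] (fun j => X ^ (d + j) * g (d + j)
        + X ^ (d + j + 1) * g (d + j + 1)) (i' - d) := by
    intro i'
    rw [map_sum]
    refine Finset.sum_congr rfl fun d _ => ?_
    rw [map_smul, smul_eq_mul]
    congr 1
    have := congrFun (hop_iterate_comp φ N (fun j => (X : ℤ[X]) ^ (d + j) • (X : ℤ[X][X]) ^ (d + j)
        + (X : ℤ[X]) ^ (d + j + 1) • (X : ℤ[X][X]) ^ (d + j + 1))) (i' - d)
    rw [Function.comp_apply] at this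
    rw [← this]
    refine congrFun (congrArg hop^[N] (funext fun j => ?_)) (i' - d)
    simp [hφ]
  rcases i with _ | i
  · exact (hB 0).symm
  · rw [prevSum, prevSum, map_add, hB, hB]

/-- The effect of two consecutive unpaired up steps, in terms of the transfer operator. -/
theorem unpaired_hop (N i : ℕ) :
    qInt (2 * (N + 1)) * prevSum (fun i' => X ^ i' * prevSum (fun i'' =>
      ∑ d ∈ Finset.range (i'' + 1), (if Even d then X ^ (i'' - d + d * N) *
        hop^[N] (fun _ => (1 : ℤ[X])) (i'' - d) else 0)) i') i =
      hop^[N + 1] (fun _ => (1 : ℤ[X])) i := by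
  set B := fun i'' => ∑ d ∈ Finset.range (i'' + 1), (if Even d then X ^ (i'' - d + d * N) *
        hop^[N] (fun _ => (1 : ℤ[X])) (i'' - d) else 0) with hB
  have h1 : (fun j : ℕ => (1 : ℤ[X]) ^ j) = fun _ => 1 := by simp
  have k1 := kernel_formula qq_self_ne_one (1 : ℤ[X]) N
  have k2 := kernel_formula qq_self_ne_one (1 : ℤ[X]) (N + 1)
  rw [h1] at k1 k2
  set a := hop^[N] (fun _ => (1 : ℤ[X])) with ha
  have e1 : PowerSeries.mk B = PowerSeries.mk (fun d => if Even d then (qq ℤ[X] ^ N) ^ d else 0) *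
      PowerSeries.rescale (qq ℤ[X]) (PowerSeries.mk a) := by
    rw [PowerSeries.rescale_mk, mk_mul_mk]
    ext1 i'
    rw [PowerSeries.coeff_mk, PowerSeries.coeff_mk, hB]
    refine Finset.sum_congr rfl fun d _ => ?_
    rw [qq_self]
    split_ifs
    · ring
    · ring
  have k1' := congrArg (PowerSeries.rescale (qq ℤ[X])) k1
  rw [map_mul, map_mul, rescale_denom, rescale_C] at k1'
  have k1'' := congrArg (PowerSeries.rescale (qq ℤ[X])) k1'
  rw [map_mul, map_mul, rescale_denom, rescale_C] at k1''
  have n1 := numer_succ' (S := ℤ[X]) N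
  have n2 := numer_succ (S := ℤ[X]) (N + 1)
  rw [numer_succ' (N + 1), n1, map_mul, map_add, map_one, PowerSeries.rescale_X] at n2
  have g := congrArg (PowerSeries.rescale (qq ℤ[X])) (even_geom_mul (qq ℤ[X] ^ N))
  rw [map_mul, map_mul, map_sub, map_add, map_one, rescale_linear, ← pow_succ'] at g
  set G := PowerSeries.rescale (qq ℤ[X]) (PowerSeries.mk
    (fun d => if Even d then (qq ℤ[X] ^ N) ^ d else 0)) with hG
  have d2 := denom_succ' (1 : ℤ[X]) (N + 1) (N + 1)
  rw [mul_one] at d2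
  have hc : kernelConst (1 : ℤ[X]) (N + 1) =
      (qInt (N + 1) * (1 + X ^ (N + 1))) * kernelConst (1 : ℤ[X]) N := by
    rw [kernelConst, Finset.prod_range_succ, ← kernelConst, mul_one, qq_self, mul_comm]
    rfl
  have hne : (1 - PowerSeries.C (qq ℤ[X] ^ (N + 1)) * PowerSeries.X : PowerSeries ℤ[X]) *
      (1 + PowerSeries.C (qq ℤ[X] ^ (N + 1)) * PowerSeries.X) ≠ 0 := by
    intro h
    rw [h, mul_zero] at g
    exact zero_ne_one g
  have e2 : PowerSeries.mk (fun i' => X ^ i' * prevSum B i') =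
      PowerSeries.rescale (qq ℤ[X]) (PowerSeries.mk (prevSum B)) := by
    rw [PowerSeries.rescale_mk, qq_self]
  -- The even link numbers sum to `1 / ((1 - Q x)(1 + Q x))` with `Q = q ^ (N + 1)`. The first
  -- factor completes `denom`, and the second cancels the last factor of `numer ℤ[X] (N + 2)`. The
  -- constants match because `[2 (N + 1)] = [N + 1] (1 + Q)`.
  have key : PowerSeries.C (qInt (2 * (N + 1))) *
      PowerSeries.mk (prevSum fun i' => X ^ i' * prevSum B i') =
      PowerSeries.mk (hop^[N + 1] fun _ => (1 : ℤ[X])) := by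
    apply mul_right_cancel₀ (mul_ne_zero hne (denom_ne_zero (1 : ℤ[X]) (N + 1 + 1) (N + 1)))
    rw [d2, hc, n1] at k2
    rw [mk_prevSum, e2, mk_prevSum, map_mul, map_add, map_one, PowerSeries.rescale_X, e1, map_mul,
      ← hG, qInt_two_mul]
    set r := PowerSeries.rescale (qq ℤ[X]) (PowerSeries.rescale (qq ℤ[X]) (PowerSeries.mk a))
    set t := PowerSeries.C (qInt (N + 1) * (1 + X ^ (N + 1)) : ℤ[X])
    rw [map_mul] at k2
    linear_combination t * (1 + PowerSeries.X) * (1 + PowerSeries.C (qq ℤ[X]) * PowerSeries.X) * r *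
      denom 1 (N + 1 + 1) (N + 1) * g + t * (1 + PowerSeries.X) *
      (1 + PowerSeries.C (qq ℤ[X]) * PowerSeries.X) * k1'' + t *
      PowerSeries.C (kernelConst 1 N) * n2
      - (1 + PowerSeries.C (qq ℤ[X] ^ (N + 1)) * PowerSeries.X) * k2
  have := congrArg (PowerSeries.coeff i) key
  rwa [PowerSeries.coeff_C_mul, PowerSeries.coeff_mk, PowerSeries.coeff_mk] at this

/-- The constant term of `kernel_formula` at `y = 1` is `∏ [k] (1 + q ^ k)`, and `[k] (1 + q ^ k) =
[2 k]`. -/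
theorem hop_iterate_one_zero (N : ℕ) :
    hop^[N] (fun _ => (1 : ℤ[X])) 0 = qEvenDoubleFactorial N := by
  have h1 : (fun j : ℕ => (1 : ℤ[X]) ^ j) = fun _ => 1 := by simp
  have k := congrArg PowerSeries.constantCoeff (kernel_formula qq_self_ne_one (1 : ℤ[X]) N)
  rw [map_mul, constantCoeff_denom, h1, mul_one, map_mul] at k
  have hn : PowerSeries.constantCoeff (numer ℤ[X] N) = 1 := by simp [numer, map_prod]
  rw [hn, mul_one, PowerSeries.constantCoeff_C, ← PowerSeries.coeff_zero_eq_constantCoeff_apply,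
    PowerSeries.coeff_mk] at k
  rw [k, qEvenDoubleFactorial, kernelConst, Finset.range_eq_Ico, Finset.prod_Ico_add'
    (fun k => algebraMap ℤ[X] ℤ[X] (qInt k) * (1 + qq ℤ[X] ^ k * 1)) 0 N 1]
  refine Finset.prod_congr ?_ fun k _ => ?_
  · ext; simp
  · rw [qInt_two_mul, mul_one, qq_self]
    rfl


/-! ### Configurations -/

/-- The condition on the link numbers of the unpaired up steps, listed from right to left. -/
def EndOK : List ℕ → Prop
  | [] => True
  | [a] => Even a
  | a :: b :: t => Even a ∧ b = t.headD 0 ∧ EndOK t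

/-- The sum of the entries of a list at its odd positions, counted from `0`. -/
def endExp : List ℕ → ℕ
  | [] => 0
  | [_] => 0
  | _ :: b :: t => b + endExp t

open Classical in
/-- The weight of the list of the link numbers of the unpaired up steps. -/
noncomputable def endWeight (st : List ℕ) : ℤ[X] := if EndOK st then X ^ endExp st else 0

open Classical in
/-- The configurations over a word: for each step the link number and the number of boxes in the
column after the step, where `i` is the number of boxes in the first column and `st` the list of
the link numbers of the up steps which are open at the beginning of the word. -/
noncomputable def cfgs : List DyckStep → List ℕ → ℕ → Finset (List (ℕ × ℕ))
  | [], st, _ => if EndOK st then {[]} else ∅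
  | DyckStep.U :: w, st, i => (Finset.Icc (i - 1) i).biUnion fun i' =>
      (Finset.Icc (st.headD 0) i').biUnion fun l => (cfgs w (l :: st) i').image ((l, i') :: ·)
  | DyckStep.D :: w, st, i => (Finset.Icc i (i + 1)).biUnion fun i' =>
      (cfgs w st.tail i').image ((st.headD 0, i') :: ·)

/-- The statistic of a configuration. -/
def wt : List DyckStep → List ℕ → List (ℕ × ℕ) → ℕ
  | [], st, _ => endExp st
  | _ :: _, _, [] => 0
  | DyckStep.U :: w, st, x :: p => (x.2 - x.1) + wt w (x.1 :: st) p
  | DyckStep.D :: w, st, x :: p => x.2 + wt w st.tail p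

/-- The generating function of the configurations over a word. -/
noncomputable def gf (w : List DyckStep) (st : List ℕ) (i : ℕ) : ℤ[X] :=
  ∑ p ∈ cfgs w st i, X ^ wt w st p

theorem gf_nil (st : List ℕ) (i : ℕ) : gf [] st i = endWeight st := by
  rw [gf, cfgs, endWeight]
  split_ifs <;> simp [wt]

theorem sum_Icc_sub_one {M : Type*} [AddCommMonoid M] (f : ℕ → M) (i : ℕ) :
    ∑ k ∈ Finset.Icc (i - 1) i, f k = prevSum f i := by
  rcases i with _ | i
  · simp [prevSum]
  · rw [Nat.add_sub_cancel, prevSum, ← Nat.succ_eq_add_one, ← Finset.insert_Icc_add_one_left_eq_Icc (Nat.le_succ i),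
      Finset.sum_insert (by simp), ← Nat.succ_eq_add_one, Finset.Icc_self, Finset.sum_singleton, add_comm]

theorem gf_up (w : List DyckStep) (st : List ℕ) (i : ℕ) :
    gf (DyckStep.U :: w) st i = prevSum (fun i' =>
      ∑ l ∈ Finset.Icc (st.headD 0) i', X ^ (i' - l) * gf w (l :: st) i') i := by
  rw [gf, cfgs, Finset.sum_biUnion, ← sum_Icc_sub_one]
  · refine Finset.sum_congr rfl fun i' _ => ?_
    rw [Finset.sum_biUnion]
    · refine Finset.sum_congr rfl fun l _ => ?_
      rw [Finset.sum_image (by simp), gf, Finset.mul_sum]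
      refine Finset.sum_congr rfl fun p _ => ?_
      rw [wt, pow_add]
    · intro l _ l' _ hl
      refine Finset.disjoint_left.2 fun p hp hp' => hl ?_
      simp only [Finset.mem_image] at hp hp'
      obtain ⟨_, _, rfl⟩ := hp
      obtain ⟨_, _, h⟩ := hp'
      simp only [List.cons.injEq, Prod.mk.injEq] at h
      exact h.1.1.symm
  · intro l _ l' _ hl
    refine Finset.disjoint_left.2 fun p hp hp' => hl ?_
    simp only [Finset.mem_image, Finset.mem_biUnion] at hp hp'
    obtain ⟨_, _, _, _, rfl⟩ := hp
    obtain ⟨_, _, _, _, h⟩ := hp'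
    simp only [List.cons.injEq, Prod.mk.injEq] at h
    exact h.1.2.symm

theorem gf_down (w : List DyckStep) (st : List ℕ) (i : ℕ) :
    gf (DyckStep.D :: w) st i =
      X ^ i * gf w st.tail i + X ^ (i + 1) * gf w st.tail (i + 1) := by
  have key : gf (DyckStep.D :: w) st i =
      ∑ i' ∈ Finset.Icc i (i + 1), X ^ i' * gf w st.tail i' := by
    rw [gf, cfgs, Finset.sum_biUnion]
    · refine Finset.sum_congr rfl fun i' _ => ?_
      rw [Finset.sum_image (by simp), gf, Finset.mul_sum]
      refine Finset.sum_congr rfl fun p _ => ?_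
      rw [wt, pow_add]
    · intro l _ l' _ hl
      refine Finset.disjoint_left.2 fun p hp hp' => hl ?_
      simp only [Finset.mem_image] at hp hp'
      obtain ⟨_, _, rfl⟩ := hp
      obtain ⟨_, _, h⟩ := hp'
      simp only [List.cons.injEq, Prod.mk.injEq] at h
      exact h.1.2.symm
  rw [key, ← Finset.insert_Icc_add_one_left_eq_Icc (Nat.le_succ i),
      Finset.sum_insert (by simp), ← Nat.succ_eq_add_one, Finset.Icc_self, Finset.sum_singleton]

theorem mul_prevSum (r : ℤ[X]) (f : ℕ → ℤ[X]) (i : ℕ) :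
    r * prevSum f i = prevSum (fun k => r * f k) i := by
  rcases i with _ | i
  · rfl
  · exact mul_add _ _ _

theorem sum_Icc_add {M : Type*} [AddCommMonoid M] (f : ℕ → M) (c i : ℕ) :
    ∑ l ∈ Finset.Icc c (c + i), f l = ∑ d ∈ Finset.range (i + 1), f (c + d) := by
  have : Finset.Icc c (c + i) = Finset.Ico c (c + (i + 1)) := by
    ext; simp; omega
  rw [this, Finset.sum_Ico_eq_sum_range, Nat.add_sub_cancel_left]

/-- Up steps from a level at or above the last open link number. -/
theorem gf_up_add (w : List DyckStep) (st : List ℕ) (c i : ℕ) (hc : st.headD 0 = c) :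
    gf (DyckStep.U :: w) st (c + i) = prevSum (fun i' =>
      ∑ d ∈ Finset.range (i' + 1), X ^ (i' - d) * gf w ((c + d) :: st) (c + i')) i := by
  rw [gf_up, prevSum_add, hc]
  · congr 1
    funext i'
    rw [sum_Icc_add]
    refine Finset.sum_congr rfl fun d _ => ?_
    rw [Nat.add_sub_add_left]
  · intro k hk
    rw [hc, Finset.Icc_eq_empty (by omega), Finset.sum_empty]

/-- The word-level form of `nest_hop`. Levels are counted from `c`. Shifting all levels and link
numbers by `c` leaves the weight of an up step unchanged and multiplies that of a down step by `X ^
c`, whence `X ^ c` for each pair. -/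
theorem gf_nest {z : List DyckStep} {H : ℤ[X]} {N : ℕ}
    (hz : ∀ w st c i, st.headD 0 = c →
      H * gf (z ++ w) st (c + i) = X ^ (c * N) * hop^[N] (fun j => gf w st (c + j)) i)
    (w : List DyckStep) (st : List ℕ) (c i : ℕ) (hc : st.headD 0 = c) :
    qInt (N + 1) * H * gf (DyckStep.U :: (z ++ DyckStep.D :: w)) st (c + i) =
      X ^ (c * (N + 1)) * hop^[N + 1] (fun j => gf w st (c + j)) i := by
  rw [← nest_hop, gf_up_add _ _ _ _ hc, mul_assoc, mul_left_comm _ (qInt (N + 1))]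
  congr 1
  rw [mul_prevSum, mul_prevSum]
  congr 1
  funext i'
  rw [Finset.mul_sum, Finset.mul_sum]
  refine Finset.sum_congr rfl fun d hd => ?_
  -- Inside the pair the last open link number is `c + d`, so the levels there are counted from it.
  have hd' : c + i' = (c + d) + (i' - d) := by
    have := Finset.mem_range.1 hd
    omega
  rw [mul_left_comm, hd', hz (DyckStep.D :: w) _ (c + d) _ rfl]
  have e : (fun j => gf (DyckStep.D :: w) ((c + d) :: st) (c + d + j)) = fun j => X ^ c *
      (X ^ (d + j) * gf w st (c + (d + j)) + X ^ (d + j + 1) * gf w st (c + (d + j + 1))) := by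
    funext j
    rw [gf_down, List.tail_cons, mul_add]
    simp only [add_assoc]
    ring
  rw [e, hop_iterate_mul]
  ring

/-! ### Words and trees -/

theorem isBallot_of_append {a b : List DyckStep} (h : IsBallot (a ++ b))
    (hc : a.count DyckStep.D = a.count DyckStep.U) : IsBallot b := by
  intro i
  have := h (a.length + i)
  rw [List.take_length_add_append, List.count_append, List.count_append] at this
  omega

theorem splitAtPartner_none {d : ℕ} {w : List DyckStep} (h : splitAtPartner d w = none) (i : ℕ) :
    (w.take i).count DyckStep.D ≤ (w.take i).count DyckStep.U + d := by
  induction w generalizing d i with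
  | nil => simp
  | cons s w ih =>
    rcases i with _ | i
    · simp
    cases s with
    | U =>
      simp only [splitAtPartner, Option.map_eq_none_iff] at h
      have := ih h i
      simp
      omega
    | D =>
      cases d with
      | zero => simp [splitAtPartner] at h
      | succ d =>
        simp only [splitAtPartner, Option.map_eq_none_iff] at h
        have := ih h i
        simp
        omega

theorem splitAtPartner_some {d : ℕ} {w z w' : List DyckStep}
    (h : splitAtPartner d w = some (z, w')) :
    (∀ i, (z.take i).count DyckStep.D ≤ (z.take i).count DyckStep.U + d) ∧
      z.count DyckStep.D = z.count DyckStep.U + d := by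
  induction w generalizing d z with
  | nil => simp [splitAtPartner] at h
  | cons s w ih =>
    cases s with
    | U =>
      simp only [splitAtPartner, Option.map_eq_some_iff] at h
      obtain ⟨⟨p, r⟩, hp, he⟩ := h
      simp only [Prod.mk.injEq] at he
      obtain ⟨rfl, rfl⟩ := he
      obtain ⟨h1, h2⟩ := ih hp
      refine ⟨fun i => ?_, ?_⟩
      · rcases i with _ | i
        · simp
        have := h1 i
        simp
        omega
      · simp
        omega
    | D =>
      cases d with
      | zero =>
        simp only [splitAtPartner, Option.some.injEq, Prod.mk.injEq] at h
        obtain ⟨rfl, rfl⟩ := h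
        simp
      | succ d =>
        simp only [splitAtPartner, Option.map_eq_some_iff] at h
        obtain ⟨⟨p, r⟩, hp, he⟩ := h
        simp only [Prod.mk.injEq] at he
        obtain ⟨rfl, rfl⟩ := he
        obtain ⟨h1, h2⟩ := ih hp
        refine ⟨fun i => ?_, ?_⟩
        · rcases i with _ | i
          · simp
          have := h1 i
          simp
          omega
        · simp
          omega

theorem isBallot_of_splitAtPartner_none {w : List DyckStep} (h : splitAtPartner 0 w = none) :
    IsBallot w := fun i => by simpa using splitAtPartner_none h i

theorem isBallot_count_le {w : List DyckStep} (h : IsBallot w) :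
    w.count DyckStep.D ≤ w.count DyckStep.U := by
  simpa using h w.length

/-- The parts of a ballot path beginning with a paired up step. -/
theorem splitAtPartner_parts {w z w' : List DyckStep} (h : splitAtPartner 0 w = some (z, w'))
    (hb : IsBallot (DyckStep.U :: w)) :
    w = z ++ DyckStep.D :: w' ∧ IsBallot z ∧ z.count DyckStep.D = z.count DyckStep.U ∧
      IsBallot w' ∧ unpairedU (DyckStep.U :: w) = unpairedU w' := by
  have hw := splitAtPartner_eq h
  obtain ⟨h1, h2⟩ := splitAtPartner_some h
  refine ⟨hw, fun i => by simpa using h1 i, by simpa using h2, ?_, ?_⟩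
  · refine isBallot_of_append (a := DyckStep.U :: (z ++ [DyckStep.D])) (by simpa [hw] using hb) ?_
    simp
    omega
  · subst hw
    simp [unpairedU]
    omega

theorem ballotTree_up_some {w z w' : List DyckStep} (h : splitAtPartner 0 w = some (z, w')) :
    ballotTree (DyckStep.U :: w) =
      .edge false (decide (Odd (unpairedU w'))) (ballotTree z) (ballotTree w') := by
  rw [ballotTree]
  split
  · rename_i h'
    rw [h] at h'
    simp only [Option.some.injEq, Prod.mk.injEq] at h'
    obtain ⟨rfl, rfl⟩ := h'
    rfl
  · rename_i h'
    rw [h] at h'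
    cases h'

theorem ballotTree_up_none {w : List DyckStep} (h : splitAtPartner 0 w = none) :
    ballotTree (DyckStep.U :: w) =
      if Even (unpairedU w) then .edge true false (ballotTree w) .root else ballotTree w := by
  rw [ballotTree]
  split
  · rename_i h'
    rw [h] at h'
    cases h'
  · rfl

/-- The denominator of the hook formula. -/
noncomputable def hookProd (t : MarkedTree) : ℤ[X] := (t.hookLengths.map qInt).prod

theorem hookProd_edge_false (a : Bool) (t t' : MarkedTree) :
    hookProd (.edge false a t t') = qInt (t.size + 1) * hookProd t * hookProd t' := by
  simp [hookProd, MarkedTree.hookLengths, mul_assoc]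

theorem hookProd_edge_true (a : Bool) (t : MarkedTree) :
    hookProd (.edge true a t .root) = qInt (2 * (t.size + 1)) * hookProd t := by
  simp [hookProd, MarkedTree.hookLengths, mul_add]

/-- Induction along `z = U z₁ D z₂`: `gf_nest` handles the first pair with the word inside it, and
the iterates belonging to the pair and to `z₂` compose. -/
theorem gf_dyck (z : List DyckStep) (hz : IsBallot z)
    (hc : z.count DyckStep.D = z.count DyckStep.U) (w : List DyckStep) (st : List ℕ) (c i : ℕ)
    (hst : st.headD 0 = c) :
    hookProd (ballotTree z) * gf (z ++ w) st (c + i) = X ^ (c * (ballotTree z).size) *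
      hop^[(ballotTree z).size] (fun j => gf w st (c + j)) i := by
  induction hn : z.length using Nat.strong_induction_on generalizing z w st c i with
  | _ n ih =>
  rcases z with _ | ⟨s, z⟩
  · simp [ballotTree, hookProd, MarkedTree.hookLengths, MarkedTree.size]
  rcases s
  · rcases h : splitAtPartner 0 z with _ | ⟨z1, z2⟩
    · have := isBallot_count_le (isBallot_of_splitAtPartner_none h)
      simp at hc
      omega
    · obtain ⟨rfl, h1, h2, h3, -⟩ := splitAtPartner_parts h hz
      rw [ballotTree_up_some h, hookProd_edge_false, MarkedTree.size]
      simp at hn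
      have g1 := gf_nest (fun w st c i hst => ih z1.length (by omega) z1 h1 h2 w st c i hst rfl)
        (z2 ++ w) st c i hst
      have h4 : z2.count DyckStep.D = z2.count DyckStep.U := by
        simp at hc
        omega
      have g2 := fun j => ih z2.length (by omega) z2 h3 h4 w st c j hst rfl
      have e : DyckStep.U :: (z1 ++ DyckStep.D :: z2) ++ w =
          DyckStep.U :: (z1 ++ DyckStep.D :: (z2 ++ w)) := by simp
      rw [e, mul_right_comm, g1, Function.iterate_add_apply _ (_ + 1), mul_assoc,
        mul_comm _ (hookProd _), ← hop_iterate_mul]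
      simp only [g2]
      rw [hop_iterate_mul]
      ring
  · have := hz 1
    simp at this

theorem endWeight_cons_cons (a b : ℕ) (st : List ℕ) :
    endWeight (a :: b :: st) =
      if Even a ∧ b = st.headD 0 then X ^ b * endWeight st else 0 := by
  rw [endWeight, endWeight, EndOK, endExp]
  split_ifs <;> first | rfl | (simp_all [pow_add])

theorem even_headD_of_endOK {st : List ℕ} (h : EndOK st) : Even (st.headD 0) := by
  rcases st with _ | ⟨a, _ | ⟨b, t⟩⟩
  · simp
  · exact h
  · exact h.1

/-- The weight of the final stack forces the left step to have link number `c` and the right one an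
even link number `c + e`. It also contributes `X ^ c`, as a pair `UD` would. -/
theorem gf_two_up {w : List DyckStep} {H : ℤ[X]} {N : ℕ}
    (hw : ∀ st c i, st.headD 0 = c → H * gf w st (c + i) =
      X ^ (c * N) * hop^[N] (fun _ => 1) i * endWeight st)
    (st : List ℕ) (c i : ℕ) (hc : st.headD 0 = c) :
    qInt (2 * (N + 1)) * H * gf (DyckStep.U :: DyckStep.U :: w) st (c + i) =
      X ^ (c * (N + 1)) * hop^[N + 1] (fun _ => 1) i * endWeight st := by
  rw [← unpaired_hop, gf_up_add _ _ _ _ hc]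
  -- Only `d = 0` survives, by the equality of link numbers required in `EndOK`.
  have inner : ∀ i' d, d ≤ i' → H * gf (DyckStep.U :: w) ((c + d) :: st) (c + i') =
      if d = 0 then X ^ (c * (N + 1)) * endWeight st * prevSum (fun i'' =>
      ∑ d ∈ Finset.range (i'' + 1), (if Even d then X ^ (i'' - d + d * N) *
        hop^[N] (fun _ => (1 : ℤ[X])) (i'' - d) else 0)) i' else 0 := by
    intro i' d hd
    have hi : c + i' = (c + d) + (i' - d) := by omega
    rw [hi, gf_up_add _ _ (c + d) _ rfl, mul_prevSum]
    have hz : ∀ i'' e, e ≤ i'' → H * gf w ((c + d + e) :: (c + d) :: st) (c + d + i'') =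
        if d = 0 then X ^ (c * (N + 1) + e * N) * endWeight st *
          (if Even e then hop^[N] (fun _ => (1 : ℤ[X])) (i'' - e) else 0) else 0 := by
      intro i'' e he
      have e' : c + d + i'' = (c + d + e) + (i'' - e) := by omega
      rw [e', hw _ (c + d + e) _ rfl, endWeight_cons_cons, hc]
      by_cases hd0 : d = 0
      · subst hd0
        by_cases hE : EndOK st
        · have hce := even_headD_of_endOK hE
          rw [hc] at hce
          have : Even (c + 0 + e) ↔ Even e := by
            simp [Nat.even_add, hce]
          simp only [this]
          by_cases hee : Even e
          · simp [hee]
            ring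
          · simp [hee]
        · simp [endWeight, hE]
      · simp [hd0]
    by_cases hd0 : d = 0
    · subst hd0
      rw [if_pos rfl, mul_prevSum]
      congr 1
      funext i''
      rw [Finset.mul_sum, Finset.mul_sum]
      refine Finset.sum_congr rfl fun e he => ?_
      rw [mul_left_comm, hz i'' e (by have := Finset.mem_range.1 he; omega), if_pos rfl]
      split_ifs
      · ring
      · ring
    · rw [if_neg hd0]
      have : (fun k => H * ∑ e ∈ Finset.range (k + 1), X ^ (k - e) *
          gf w ((c + d + e) :: (c + d) :: st) (c + d + k)) = fun _ => 0 := by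
        funext k
        rw [Finset.mul_sum]
        refine Finset.sum_eq_zero fun e he => ?_
        rw [mul_left_comm, hz k e (by have := Finset.mem_range.1 he; omega), if_neg hd0, mul_zero]
      rw [this]
      rcases i' - d with _ | k <;> simp [prevSum]
  rw [mul_assoc, mul_left_comm (X ^ _) (qInt _), mul_assoc, mul_right_comm (X ^ _)]
  congr 1
  rw [mul_prevSum, mul_prevSum]
  congr 1
  funext i'
  rw [Finset.mul_sum, Finset.sum_eq_single 0]
  · rw [mul_left_comm, inner i' 0 (Nat.zero_le _), if_pos rfl]
    simp
    ring
  · intro d hd hd0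
    rw [mul_left_comm, inner i' d (by have := Finset.mem_range.1 hd; omega), if_neg hd0, mul_zero]
  · simp

/-- A ballot path without arrows which begins with an unpaired up step and an odd number of
unpaired up steps after it begins with two unpaired up steps. -/
theorem exists_up_of_odd {w : List DyckStep} (hb : IsBallot w) (ho : Odd (unpairedU w))
    (hT : (ballotTree w).NoArrows) :
    ∃ w', w = DyckStep.U :: w' ∧ IsBallot w' ∧ Even (unpairedU w') ∧
      ballotTree w = .edge true false (ballotTree w') .root := by
  rcases w with _ | ⟨s, w⟩
  · simp [unpairedU] at ho
  rcases s
  · refine ⟨w, rfl, ?_⟩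
    rcases h : splitAtPartner 0 w with _ | ⟨z, w'⟩
    · have hw := isBallot_of_splitAtPartner_none h
      have hle := isBallot_count_le hw
      have he : Even (unpairedU w) := by
        simp only [unpairedU, List.count_cons_self] at ho ⊢
        have : (List.count DyckStep.D (DyckStep.U :: w)) = w.count DyckStep.D := by simp
        rw [this, Nat.succ_sub hle] at ho
        simpa [Nat.odd_add_one] using ho
      exact ⟨hw, he, by rw [ballotTree_up_none h, if_pos he]⟩
    · obtain ⟨rfl, h1, h2, h3, h4⟩ := splitAtPartner_parts h hb
      rw [ballotTree_up_some h] at hT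
      rw [h4] at ho
      simp [MarkedTree.NoArrows, ho] at hT
  · have := hb 1
    simp at this

/-- A word with an even number of unpaired up steps starts with a paired step, treated by `gf_nest`,
or with an unpaired one. In the latter case an odd number of unpaired steps follows and the absence
of arrows makes the next letter an unpaired `U` as well, so `gf_two_up` applies. -/
theorem gf_even (w : List DyckStep) (hb : IsBallot w) (hT : (ballotTree w).NoArrows)
    (he : Even (unpairedU w)) (st : List ℕ) (c i : ℕ) (hst : st.headD 0 = c) :
    hookProd (ballotTree w) * gf w st (c + i) = X ^ (c * (ballotTree w).size) *
      hop^[(ballotTree w).size] (fun _ => 1) i * endWeight st := by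
  induction hn : w.length using Nat.strong_induction_on generalizing w st c i with
  | _ n ih =>
  rcases w with _ | ⟨s, w⟩
  · simp [ballotTree, hookProd, MarkedTree.hookLengths, MarkedTree.size, gf_nil]
  rcases s
  · simp at hn
    rcases h : splitAtPartner 0 w with _ | ⟨z, w'⟩
    · have hw := isBallot_of_splitAtPartner_none h
      have hle := isBallot_count_le hw
      have ho : Odd (unpairedU w) := by
        simp only [unpairedU, List.count_cons_self] at he ⊢
        have : (List.count DyckStep.D (DyckStep.U :: w)) = w.count DyckStep.D := by simp
        rw [this, Nat.succ_sub hle] at he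
        simpa [Nat.even_add_one] using he
      rw [ballotTree_up_none h, if_neg (Nat.not_even_iff_odd.2 ho)] at hT ⊢
      obtain ⟨w', rfl, hb', he', ht⟩ := exists_up_of_odd hw ho hT
      rw [ht] at hT ⊢
      simp at hn
      rw [hookProd_edge_true, MarkedTree.size, MarkedTree.size, add_zero]
      exact gf_two_up (fun st c i hst => ih w'.length (by omega) w' hb' hT.2.1 he' st c i hst rfl)
        st c i hst
    · obtain ⟨rfl, h1, h2, h3, h4⟩ := splitAtPartner_parts h hb
      rw [ballotTree_up_some h] at hT ⊢
      rw [hookProd_edge_false, MarkedTree.size]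
      simp at hn
      have g1 := gf_nest (fun w st c i hst => gf_dyck z h1 h2 w st c i hst) w' st c i hst
      have g2 := fun j => ih w'.length (by omega) w' h3 hT.2.2 (h4 ▸ he) st c j hst rfl
      rw [mul_right_comm, g1, Function.iterate_add_apply _ (_ + 1), mul_assoc,
        mul_comm _ (hookProd _), ← hop_iterate_mul]
      simp only [g2]
      have e : (fun j => X ^ (c * (ballotTree w').size) *
          hop^[(ballotTree w').size] (fun _ => (1 : ℤ[X])) j * endWeight st) =
          fun j => (X ^ (c * (ballotTree w').size) * endWeight st) *
          hop^[(ballotTree w').size] (fun _ => (1 : ℤ[X])) j := by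
        funext j; ring
      rw [e, hop_iterate_mul]
      ring
  · have := hb 1
    simp at this

theorem qEvenDoubleFactorial_succ (n : ℕ) :
    qEvenDoubleFactorial (n + 1) = qEvenDoubleFactorial n * qInt (2 * (n + 1)) :=
  Finset.prod_Icc_succ_top (by omega) _

/-- If the number of unpaired up steps is odd, the word starts with one whose dotted edge lies above
the whole rest of the tree; its hook factor is the last factor of `[2N]!!`. -/
theorem hookProd_mul_gf (w : List DyckStep) (hb : IsBallot w) (hT : (ballotTree w).NoArrows) :
    hookProd (ballotTree w) * gf w [] 0 = qEvenDoubleFactorial (ballotTree w).size := by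
  rcases Nat.even_or_odd (unpairedU w) with he | ho
  · have := gf_even w hb hT he [] 0 0 rfl
    rw [hop_iterate_one_zero] at this
    simpa [endWeight, EndOK, endExp] using this
  · obtain ⟨w', rfl, hb', he', ht⟩ := exists_up_of_odd hb ho hT
    rw [ht] at hT ⊢
    -- At level `0` the leading up step can only have link number `0`.
    have h1 := gf_even w' hb' hT.2.1 he' [0] 0 0 rfl
    have h2 := gf_up_add w' [] 0 0 rfl
    rw [hop_iterate_one_zero] at h1
    simp [endWeight, EndOK, endExp] at h1
    simp [prevSum] at h2
    rw [h2, hookProd_edge_true, mul_assoc, h1, MarkedTree.size, MarkedTree.size, add_zero,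
      qEvenDoubleFactorial_succ, mul_comm]


/-! ### Heights -/

theorem height_zero (w : List DyckStep) : height w 0 = 0 := by simp [height]

theorem height_succ (w : List DyckStep) (x : ℕ) : height w (x + 1) = height w x +
    match w[x]? with
    | some DyckStep.U => 1
    | some DyckStep.D => -1
    | none => 0 := by
  simp only [height, List.take_add_one, List.count_append]
  rcases w[x]? with _ | ⟨_ | _⟩ <;> simp <;> ring

theorem height_up {w : List DyckStep} {x : ℕ} (h : w[x]? = some DyckStep.U) :
    height w (x + 1) = height w x + 1 := by rw [height_succ, h]

theorem height_down {w : List DyckStep} {x : ℕ} (h : w[x]? = some DyckStep.D) :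
    height w (x + 1) = height w x - 1 := by
  rw [height_succ, h]
  rfl

theorem step_cases {w : List DyckStep} {x : ℕ} (hx : x < w.length) :
    w[x]? = some DyckStep.U ∨ w[x]? = some DyckStep.D := by
  rw [List.getElem?_eq_getElem hx]
  rcases w[x] <;> simp

theorem lt_length_of_getElem? {w : List DyckStep} {x : ℕ} {s : DyckStep} (h : w[x]? = some s) :
    x < w.length := (List.getElem?_eq_some_iff.1 h).1

theorem isBallot_iff {w : List DyckStep} : IsBallot w ↔ ∀ x, 0 ≤ height w x := by
  simp [IsBallot, height]

theorem height_of_length_le {w : List DyckStep} {x : ℕ} (hx : w.length ≤ x) :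
    height w x = height w w.length := by
  simp [height, List.take_of_length_le hx]

/-- The first visit of a height by a path that rises. -/
theorem exists_last_height {w : List DyckStep} {a b : ℕ} (hab : a ≤ b)
    (h : height w a ≤ height w b) :
    ∃ u, a ≤ u ∧ u ≤ b ∧ height w u = height w a ∧ ∀ z, u < z → z ≤ b → height w a < height w z := by
  induction b, hab using Nat.le_induction with
  | base => exact ⟨a, le_rfl, le_rfl, rfl, fun z h1 h2 => by omega⟩
  | succ b hab ih =>
    by_cases hb : height w (b + 1) = height w a
    · exact ⟨b + 1, by omega, le_rfl, hb, fun z h1 h2 => by omega⟩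
    · have hs := height_succ w b
      have : height w a ≤ height w b := by
        rcases hw : w[b]? with _ | ⟨_ | _⟩ <;> simp only [hw] at hs <;> omega
      obtain ⟨u, h1, h2, h3, h4⟩ := ih this
      refine ⟨u, h1, by omega, h3, fun z hz1 hz2 => ?_⟩
      rcases Nat.lt_or_ge b z with hz | hz
      · obtain rfl : z = b + 1 := by omega
        omega
      · exact h4 z hz1 hz

theorem height_up_of_forall_lt {w : List DyckStep} {u : ℕ} (h : height w u < height w (u + 1)) :
    w[u]? = some DyckStep.U := by
  have hs := height_succ w u
  rcases hw : w[u]? with _ | ⟨_ | _⟩ <;> simp only [hw] at hs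
  · omega
  · rfl
  · omega

/-! ### The stack of the open up steps -/

/-- The link numbers of the up steps that are open at abscissa `x`, from right to left. -/
def stk (w : List DyckStep) (l : ℕ → ℕ) : ℕ → List ℕ
  | 0 => []
  | x + 1 =>
    match w[x]? with
    | some DyckStep.U => l x :: stk w l x
    | some DyckStep.D => (stk w l x).tail
    | none => stk w l x

section Stack

variable {w : List DyckStep} {l : ℕ → ℕ}

theorem stk_up {x : ℕ} (h : w[x]? = some DyckStep.U) : stk w l (x + 1) = l x :: stk w l x := by
  rw [stk, h]

theorem stk_down {x : ℕ} (h : w[x]? = some DyckStep.D) : stk w l (x + 1) = (stk w l x).tail := by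
  rw [stk, h]

theorem stk_none {x : ℕ} (h : w[x]? = none) : stk w l (x + 1) = stk w l x := by
  rw [stk, h]

theorem length_stk (hb : IsBallot w) (x : ℕ) : ((stk w l x).length : ℤ) = height w x := by
  induction x with
  | zero => simp [stk, height_zero]
  | succ x ih =>
    have h0 := isBallot_iff.1 hb (x + 1)
    have hs := height_succ w x
    rcases hw : w[x]? with _ | ⟨_ | _⟩ <;> simp only [hw] at hs
    · rw [stk_none hw]; omega
    · rw [stk_up hw, List.length_cons]; push_cast; omega
    · rw [stk_down hw, List.length_tail]; omega

/-- The stacks at two abscissas have the same lower part, as far as the path does not descend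
below it in between. -/
theorem stk_common (hb : IsBallot w) {y p : ℕ} (hyp : y ≤ p) (H : ℕ)
    (h : ∀ z, y ≤ z → z ≤ p → (H : ℤ) ≤ height w z) :
    ∃ t t' s, stk w l y = t ++ s ∧ stk w l p = t' ++ s ∧ s.length = H := by
  induction p, hyp using Nat.le_induction with
  | base =>
    have hl := length_stk (l := l) hb y
    have := h y le_rfl le_rfl
    refine ⟨(stk w l y).take ((stk w l y).length - H), (stk w l y).take ((stk w l y).length - H),
      (stk w l y).drop ((stk w l y).length - H), by simp, by simp, ?_⟩
    rw [List.length_drop]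
    omega
  | succ p hyp ih =>
    obtain ⟨t, t', s, h1, h2, h3⟩ := ih fun z hz1 hz2 => h z hz1 (by omega)
    rcases hw : w[p]? with _ | ⟨_ | _⟩
    · exact ⟨t, t', s, h1, by rw [stk_none hw, h2], h3⟩
    · exact ⟨t, l p :: t', s, h1, by rw [stk_up hw, h2, List.cons_append], h3⟩
    · refine ⟨t, t'.tail, s, h1, ?_, h3⟩
      rw [stk_down hw, h2]
      refine List.tail_append_of_ne_nil ?_
      rintro rfl
      have := h (p + 1) (by omega) le_rfl
      have hd := height_down hw
      have hl := length_stk (l := l) hb p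
      rw [h2, List.nil_append, h3] at hl
      omega

/-- An up step that is still open. -/
theorem stk_of_open (hb : IsBallot w) {x p : ℕ} (hx : w[x]? = some DyckStep.U) (hxp : x < p)
    (h : ∀ z, x < z → z ≤ p → height w x < height w z) :
    ∃ t, stk w l p = t ++ l x :: stk w l x ∧ (t.length : ℤ) = height w p - height w x - 1 := by
  have h0 := isBallot_iff.1 hb x
  obtain ⟨t, t', s, h1, h2, h3⟩ := stk_common (l := l) hb (Nat.succ_le_of_lt hxp)
    (height w x + 1).toNat fun z hz1 hz2 => by
      have := h z hz1 hz2
      omega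
  have hl := length_stk (l := l) hb (x + 1)
  have hl' := length_stk (l := l) hb p
  have hu := height_up hx
  have ht : t = [] := by
    rw [Nat.succ_eq_add_one] at h1
    rw [h1, List.length_append] at hl
    rw [← List.length_eq_zero_iff]
    omega
  rw [ht, List.nil_append, Nat.succ_eq_add_one, stk_up hx] at h1
  refine ⟨t', by rw [h2, h1], ?_⟩
  rw [h2, List.length_append] at hl'
  push_cast at hl'
  omega

/-- The top of a nonempty stack belongs to an open up step. -/
theorem exists_open {p : ℕ} (hp : 0 < height w p) :
    ∃ x, x < p ∧ w[x]? = some DyckStep.U ∧ height w x = height w p - 1 ∧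
      (∀ z, x < z → z ≤ p → height w x < height w z) ∧ stk w l p = l x :: stk w l x := by
  induction p using Nat.strong_induction_on with
  | _ p ih =>
  rcases p with _ | p
  · simp [height_zero] at hp
  have hs := height_succ w p
  rcases hw : w[p]? with _ | ⟨_ | _⟩ <;> simp only [hw] at hs
  · obtain ⟨x, h1, h2, h3, h4, h5⟩ := ih p (by omega) (by omega)
    refine ⟨x, by omega, h2, by omega, fun z hz1 hz2 => ?_, by rw [stk_none hw, h5]⟩
    rcases Nat.lt_or_ge p z with hz | hz
    · obtain rfl : z = p + 1 := by omega
      omega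
    · exact h4 z hz1 hz
  · refine ⟨p, by omega, hw, by omega, fun z hz1 hz2 => ?_, stk_up hw⟩
    obtain rfl : z = p + 1 := by omega
    omega
  · obtain ⟨x1, h1, h2, h3, h4, h5⟩ := ih p (by omega) (by omega)
    obtain ⟨x, g1, g2, g3, g4, g5⟩ := ih x1 (by omega) (by omega)
    refine ⟨x, by omega, g2, by omega, fun z hz1 hz2 => ?_, by
      rw [stk_down hw, h5, List.tail_cons, g5]⟩
    rcases Nat.lt_or_ge p z with hz | hz
    · obtain rfl : z = p + 1 := by omega
      omega
    · rcases Nat.lt_or_ge x1 z with hz' | hz'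
      · have := h4 z hz' hz
        omega
      · exact g4 z hz1 hz'

theorem stk_eq_nil (hb : IsBallot w) {p : ℕ} (hp : ¬ 0 < height w p) : stk w l p = [] := by
  have := length_stk (l := l) hb p
  rw [← List.length_eq_zero_iff]
  omega

/-- The link numbers follow the pairing of the steps of the path, and do not decrease from outer
to inner pairs. -/
structure LinkOK (w : List DyckStep) (l : ℕ → ℕ) : Prop where
  up : ∀ x, w[x]? = some DyckStep.U → (stk w l x).headD 0 ≤ l x
  down : ∀ x, w[x]? = some DyckStep.D → l x = (stk w l x).headD 0

theorem LinkOK.pairwise (h : LinkOK w l) (p : ℕ) : (stk w l p).Pairwise (· ≥ ·) := by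
  induction p with
  | zero => simp [stk]
  | succ p ih =>
    rcases hw : w[p]? with _ | ⟨_ | _⟩
    · rwa [stk_none hw]
    · rw [stk_up hw, List.pairwise_cons]
      refine ⟨fun a ha => ?_, ih⟩
      have hu := h.up p hw
      rcases hs : stk w l p with _ | ⟨c, t⟩
      · simp [hs] at ha
      · rw [hs] at ha hu ih
        rcases List.mem_cons.1 ha with rfl | ha
        · exact hu
        · exact ((List.pairwise_cons.1 ih).1 a ha).trans hu
    · rw [stk_down hw]
      exact ih.sublist (List.tail_sublist _)

theorem LinkOK.le_of_mem (h : LinkOK w l) {p : ℕ} (hp : p < w.length) {a : ℕ}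
    (ha : a ∈ stk w l p) : a ≤ l p := by
  have hl : (stk w l p).headD 0 ≤ l p := by
    rcases step_cases hp with hw | hw
    · exact h.up p hw
    · exact (h.down p hw).ge
  have hs := h.pairwise p
  rcases he : stk w l p with _ | ⟨c, t⟩
  · simp [he] at ha
  · rw [he] at ha hl hs
    rcases List.mem_cons.1 ha with rfl | ha
    · exact hl
    · exact ((List.pairwise_cons.1 hs).1 a ha).trans hl

theorem LinkOK.le_of_mem_succ (h : LinkOK w l) {p : ℕ} (hp : p < w.length) {a : ℕ}
    (ha : a ∈ stk w l (p + 1)) : a ≤ l p := by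
  rcases step_cases hp with hw | hw
  · rw [stk_up hw] at ha
    rcases List.mem_cons.1 ha with rfl | ha
    · exact le_rfl
    · exact h.le_of_mem hp ha
  · rw [stk_down hw] at ha
    exact h.le_of_mem hp (List.mem_of_mem_tail ha)

/-- Every step inside an open up step has at least the same link number. -/
theorem LinkOK.le_inside_up (h : LinkOK w l) (hb : IsBallot w) {x y : ℕ}
    (hx : w[x]? = some DyckStep.U) (hxy : x ≤ y) (hy : y < w.length)
    (hz : ∀ z, x < z → z ≤ y → height w x < height w z) : l x ≤ l y := by
  rcases hxy.eq_or_lt with rfl | hxy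
  · exact le_rfl
  obtain ⟨t, ht, -⟩ := stk_of_open (l := l) hb hx hxy hz
  exact h.le_of_mem hy (by rw [ht]; simp)

/-- Every step inside the pair of a down step has at least the same link number. -/
theorem LinkOK.le_inside_down (h : LinkOK w l) (hb : IsBallot w) {x y : ℕ}
    (hx : w[x]? = some DyckStep.D) (hyx : y < x)
    (hz : ∀ z, y < z → z ≤ x → height w x ≤ height w z) : l x ≤ l y := by
  have hpos : 0 < height w x := by
    have := isBallot_iff.1 hb (x + 1)
    have := height_down hx
    omega
  obtain ⟨t, t', s, h1, h2, h3⟩ := stk_common (l := l) hb (Nat.succ_le_of_lt hyx)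
    (height w x).toNat fun z hz1 hz2 => by
      have := hz z hz1 hz2
      omega
  have hl := length_stk (l := l) hb x
  have ht : t' = [] := by
    rw [h2, List.length_append] at hl
    rw [← List.length_eq_zero_iff]
    omega
  rw [ht, List.nil_append] at h2
  rw [h.down x hx, h2]
  rcases s with _ | ⟨c, s⟩
  · simp at h3
    omega
  · exact h.le_of_mem_succ (hyx.trans (lt_length_of_getElem? hx)) (by
      rw [← Nat.succ_eq_add_one, h1]; simp)

end Stack

/-! ### Configurations as functions -/

/-- The link number of a step in a configuration. -/
def lnk (p : List (ℕ × ℕ)) (x : ℕ) : ℕ := (p.getD x (0, 0)).1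

/-- The number of boxes in a column of a configuration. -/
def col (p : List (ℕ × ℕ)) : ℕ → ℕ
  | 0 => 0
  | x + 1 => (p.getD x (0, 0)).2

/-- The numbers of boxes in the columns between the path `w` and a path above it. -/
structure ColOK (w : List DyckStep) (m : ℕ → ℕ) : Prop where
  zero : m 0 = 0
  up : ∀ x, w[x]? = some DyckStep.U → m x - 1 ≤ m (x + 1) ∧ m (x + 1) ≤ m x
  down : ∀ x, w[x]? = some DyckStep.D → m x ≤ m (x + 1) ∧ m (x + 1) ≤ m x + 1

/-- The conditions on the numbers of boxes in the columns and on the link numbers. -/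
structure CfgOK (w : List DyckStep) (m l : ℕ → ℕ) : Prop where
  col : ColOK w m
  link : LinkOK w l
  le : ∀ x, w[x]? = some DyckStep.U → l x ≤ m (x + 1)
  endOK : EndOK (stk w l w.length)

theorem mem_cfgs_up {w : List DyckStep} {st : List ℕ} {i : ℕ} {x : ℕ × ℕ} {p : List (ℕ × ℕ)} :
    x :: p ∈ cfgs (DyckStep.U :: w) st i ↔ (i - 1 ≤ x.2 ∧ x.2 ≤ i) ∧
      (st.headD 0 ≤ x.1 ∧ x.1 ≤ x.2) ∧ p ∈ cfgs w (x.1 :: st) x.2 := by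
  simp only [cfgs, Finset.mem_biUnion, Finset.mem_image, Finset.mem_Icc, List.cons.injEq]
  constructor
  · rintro ⟨i', hi, l, hl, p', hp, rfl, rfl⟩
    exact ⟨hi, hl, hp⟩
  · rintro ⟨hi, hl, hp⟩
    exact ⟨x.2, hi, x.1, hl, p, hp, rfl, rfl⟩

theorem mem_cfgs_down {w : List DyckStep} {st : List ℕ} {i : ℕ} {x : ℕ × ℕ} {p : List (ℕ × ℕ)} :
    x :: p ∈ cfgs (DyckStep.D :: w) st i ↔ (i ≤ x.2 ∧ x.2 ≤ i + 1) ∧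
      x.1 = st.headD 0 ∧ p ∈ cfgs w st.tail x.2 := by
  simp only [cfgs, Finset.mem_biUnion, Finset.mem_image, Finset.mem_Icc, List.cons.injEq]
  constructor
  · rintro ⟨i', hi, p', hp, rfl, rfl⟩
    exact ⟨hi, rfl, hp⟩
  · rintro ⟨hi, hl, hp⟩
    exact ⟨x.2, hi, p, hp, by rw [← hl], rfl⟩

theorem length_of_mem_cfgs {w : List DyckStep} {st : List ℕ} {i : ℕ} {p : List (ℕ × ℕ)}
    (h : p ∈ cfgs w st i) : p.length = w.length := by
  induction w generalizing st i p with
  | nil =>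
    rw [cfgs] at h
    split_ifs at h <;> simp_all
  | cons s w ih =>
    rcases s
    · simp only [cfgs, Finset.mem_biUnion, Finset.mem_image] at h
      obtain ⟨_, _, _, _, p', hp, rfl⟩ := h
      simp [ih hp]
    · simp only [cfgs, Finset.mem_biUnion, Finset.mem_image] at h
      obtain ⟨_, _, p', hp, rfl⟩ := h
      simp [ih hp]

/-- The recursion unrolled from the end of the word: all that a suffix needs to know of the prefix
is the stack of open link numbers and the current level. -/
theorem drop_mem_cfgs_iff {w : List DyckStep} {p : List (ℕ × ℕ)} (hp : p.length = w.length)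
    {k : ℕ} (hk : k ≤ w.length) :
    p.drop k ∈ cfgs (w.drop k) (stk w (lnk p) k) (col p k) ↔
      (∀ x, k ≤ x → (w[x]? = some DyckStep.U → (col p x - 1 ≤ col p (x + 1) ∧
          col p (x + 1) ≤ col p x) ∧ (stk w (lnk p) x).headD 0 ≤ lnk p x ∧
          lnk p x ≤ col p (x + 1)) ∧
        (w[x]? = some DyckStep.D → (col p x ≤ col p (x + 1) ∧
          col p (x + 1) ≤ col p x + 1) ∧ lnk p x = (stk w (lnk p) x).headD 0)) ∧
        EndOK (stk w (lnk p) w.length) := by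
  induction hk using Nat.decreasingInduction with
  | self =>
    rw [List.drop_length, ← hp, List.drop_length, hp, cfgs]
    have : ∀ x, w.length ≤ x → w[x]? = none := fun x hx => List.getElem?_eq_none hx
    constructor
    · intro h
      split_ifs at h with h'
      · exact ⟨fun x hx => by simp [this x hx], h'⟩
      · simp at h
    · rintro ⟨-, h⟩
      simp [h]
  | of_succ k hk ih =>
    have hk' : k < p.length := by omega
    have hcol : col p (k + 1) = p[k].2 := by simp [col, hk']
    have hlnk : lnk p k = p[k].1 := by simp [lnk, hk']
    rw [List.drop_eq_getElem_cons hk, List.drop_eq_getElem_cons hk']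
    have hsplit : ∀ P : ℕ → Prop, (∀ x, k ≤ x → P x) ↔ P k ∧ ∀ x, k + 1 ≤ x → P x := fun P =>
      ⟨fun h => ⟨h k le_rfl, fun x hx => h x (by omega)⟩, fun h x hx => by
        rcases hx.eq_or_lt with rfl | hx
        · exact h.1
        · exact h.2 x hx⟩
    rw [hsplit]
    rcases step_cases hk with hw | hw
    · have hw' : w[k] = DyckStep.U := by
        rw [List.getElem?_eq_getElem hk] at hw
        exact Option.some.inj hw
      rw [hw', mem_cfgs_up, ← hcol, ← hlnk, ← stk_up hw, ih, hw]
      simp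
      tauto
    · have hw' : w[k] = DyckStep.D := by
        rw [List.getElem?_eq_getElem hk] at hw
        exact Option.some.inj hw
      rw [hw', mem_cfgs_down, ← hcol, ← hlnk, ← stk_down hw, ih, hw]
      simp
      tauto

theorem mem_cfgs_iff {w : List DyckStep} {p : List (ℕ × ℕ)} :
    p ∈ cfgs w [] 0 ↔ p.length = w.length ∧ CfgOK w (col p) (lnk p) := by
  constructor
  · intro h
    have hp := length_of_mem_cfgs h
    obtain ⟨h1, h2⟩ := (drop_mem_cfgs_iff hp (Nat.zero_le _)).1 (by simpa [stk, col] using h)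
    exact ⟨hp, ⟨rfl, fun x hx => ((h1 x (Nat.zero_le x)).1 hx).1,
      fun x hx => ((h1 x (Nat.zero_le x)).2 hx).1⟩,
      ⟨fun x hx => ((h1 x (Nat.zero_le x)).1 hx).2.1,
        fun x hx => ((h1 x (Nat.zero_le x)).2 hx).2⟩,
      fun x hx => ((h1 x (Nat.zero_le x)).1 hx).2.2, h2⟩
  · rintro ⟨hp, h⟩
    simpa [stk, col] using (drop_mem_cfgs_iff hp (Nat.zero_le _)).2 ⟨fun x _ =>
      ⟨fun hx => ⟨h.col.up x hx, h.link.up x hx, h.le x hx⟩,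
        fun hx => ⟨h.col.down x hx, h.link.down x hx⟩⟩, h.endOK⟩

/-- The statistic of a configuration, in terms of functions. -/
def cfgStat (w : List DyckStep) (m l : ℕ → ℕ) : ℕ :=
  ∑ x ∈ Finset.range w.length,
    (if w[x]? = some DyckStep.U then m (x + 1) - l x else m (x + 1)) + endExp (stk w l w.length)

theorem wt_drop {w : List DyckStep} {p : List (ℕ × ℕ)} (hp : p.length = w.length)
    {k : ℕ} (hk : k ≤ w.length) :
    wt (w.drop k) (stk w (lnk p) k) (p.drop k) = ∑ x ∈ Finset.Ico k w.length,
      (if w[x]? = some DyckStep.U then col p (x + 1) - lnk p x else col p (x + 1)) +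
        endExp (stk w (lnk p) w.length) := by
  induction hk using Nat.decreasingInduction with
  | self => simp [wt]
  | of_succ k hk ih =>
    have hk' : k < p.length := by omega
    have hcol : col p (k + 1) = p[k].2 := by simp [col, hk']
    have hlnk : lnk p k = p[k].1 := by simp [lnk, hk']
    rw [List.drop_eq_getElem_cons hk, List.drop_eq_getElem_cons hk',
      Finset.sum_eq_sum_Ico_succ_bot hk, add_assoc, ← ih]
    rcases step_cases hk with hw | hw
    · have hw' : w[k] = DyckStep.U := by
        rw [List.getElem?_eq_getElem hk] at hw
        exact Option.some.inj hw
      rw [hw', wt, hw, if_pos rfl, stk_up hw, hcol, hlnk]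
    · have hw' : w[k] = DyckStep.D := by
        rw [List.getElem?_eq_getElem hk] at hw
        exact Option.some.inj hw
      rw [hw', wt, hw, if_neg (by simp), stk_down hw, hcol]

theorem wt_eq_cfgStat {w : List DyckStep} {p : List (ℕ × ℕ)} (hp : p.length = w.length) :
    wt w [] p = cfgStat w (col p) (lnk p) := by
  have := wt_drop hp (Nat.zero_le _)
  rw [List.drop_zero, List.drop_zero, stk] at this
  rw [this, cfgStat, Finset.range_eq_Ico]


/-! ### Rows of boxes -/

/-- The box in column `x` and in the row `j` above the path `w`. -/
def box (w : List DyckStep) (x j : ℕ) : ℕ × ℤ := (x, height w x + 1 + 2 * (j : ℤ))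

/-- The boxes of the row `j` in the columns from `a` to `b`. -/
def row (w : List DyckStep) (a b j : ℕ) : Finset (ℕ × ℤ) :=
  (Finset.Icc a b).image fun x => box w x j

theorem box_inj {w : List DyckStep} {x j x' j' : ℕ} : box w x j = box w x' j' ↔ x = x' ∧ j = j' := by
  simp only [box, Prod.mk.injEq]
  constructor
  · rintro ⟨rfl, h⟩
    exact ⟨rfl, by omega⟩
  · rintro ⟨rfl, rfl⟩
    exact ⟨rfl, rfl⟩

theorem box_mem_row {w : List DyckStep} {a b j x i : ℕ} :
    box w x i ∈ row w a b j ↔ i = j ∧ a ≤ x ∧ x ≤ b := by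
  simp only [row, Finset.mem_image, Finset.mem_Icc, box_inj]
  constructor
  · rintro ⟨x', h, rfl, rfl⟩
    exact ⟨rfl, h⟩
  · rintro ⟨rfl, h⟩
    exact ⟨x, h, rfl, rfl⟩

theorem card_row (w : List DyckStep) (a b j : ℕ) : (row w a b j).card = b + 1 - a := by
  rw [row, Finset.card_image_of_injOn, Nat.card_Icc]
  intro x _ x' _ h
  exact (box_inj.1 h).1

theorem row_inj {w : List DyckStep} {a b j a' b' j' : ℕ} (hab : a ≤ b)
    (h : row w a b j = row w a' b' j') : a = a' ∧ b = b' ∧ j = j' := by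
  have h1 : box w a j ∈ row w a' b' j' := by rw [← h, box_mem_row]; omega
  have h2 : box w b j ∈ row w a' b' j' := by rw [← h, box_mem_row]; omega
  rw [box_mem_row] at h1 h2
  have h3 : box w a' j' ∈ row w a b j := by rw [h, box_mem_row]; omega
  have h4 : box w b' j' ∈ row w a b j := by rw [h, box_mem_row]; omega
  rw [box_mem_row] at h3 h4
  omega

theorem height_take_drop {w : List DyckStep} {a k i : ℕ} (hi : i ≤ k) :
    height ((w.drop a).take k) i = height w (a + i) - height w a := by
  simp only [height, List.take_take, min_eq_left hi]
  rw [List.take_add, List.count_append, List.count_append]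
  push_cast
  ring

theorem height_length (w : List DyckStep) :
    height w w.length = (w.count DyckStep.U : ℤ) - w.count DyckStep.D := by
  simp [height]

theorem length_eq_count (w : List DyckStep) :
    w.length = w.count DyckStep.U + w.count DyckStep.D := by
  induction w with
  | nil => rfl
  | cons s w ih => rcases s <;> simp [ih] <;> omega

/-- The centers of a row reproduce a segment of `w`, so the ballot path of the tile is that segment.
-/
theorem isTile_row_iff {w : List DyckStep} {a b j n n' : ℕ} (hab : a ≤ b) (hb : b ≤ w.length) :
    IsTile n n' (row w a b j) ↔ b = a + (2 * n + n') ∧ height w b = height w a + n' ∧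
      ∀ z, a ≤ z → z ≤ b → height w a ≤ height w z := by
  constructor
  · rintro ⟨v, hv, hU, hD, a', y, ht⟩
    have hmem : ∀ i, i ≤ 2 * n + n' → ∃ x, a ≤ x ∧ x ≤ b ∧ x = a' + i ∧
        height w x + 1 + 2 * (j : ℤ) = y + height v i := by
      intro i hi
      have : (a' + i, y + height v i) ∈ row w a b j := by
        rw [ht, Finset.mem_image]
        exact ⟨i, by simpa using hi, rfl⟩
      rw [row, Finset.mem_image] at this
      obtain ⟨x, hx, he⟩ := this
      rw [box, Prod.mk.injEq] at he
      rw [Finset.mem_Icc] at hx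
      exact ⟨x, hx.1, hx.2, he.1, he.2⟩
    have hmem' : ∀ x, a ≤ x → x ≤ b → ∃ i, i ≤ 2 * n + n' ∧ x = a' + i := by
      intro x hxa hxb
      have : box w x j ∈ row w a b j := by rw [box_mem_row]; omega
      rw [ht, Finset.mem_image] at this
      obtain ⟨i, hi, he⟩ := this
      rw [box, Prod.mk.injEq] at he
      rw [Finset.mem_range] at hi
      exact ⟨i, by omega, he.1.symm⟩
    obtain ⟨i1, hi1, e1⟩ := hmem' a le_rfl hab
    obtain ⟨i2, hi2, e2⟩ := hmem' b hab le_rfl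
    obtain ⟨x0, hx0, hx0', e3, y0⟩ := hmem 0 (Nat.zero_le _)
    obtain ⟨x1, hx1, hx1', e4, y1⟩ := hmem (2 * n + n') le_rfl
    have ha : a = a' := by omega
    have hx0a : x0 = a := by omega
    have hx1b : x1 = b := by omega
    rw [height_zero, hx0a] at y0
    have hlen : v.length = 2 * n + n' := by rw [length_eq_count, hU, hD]; ring
    have hh := height_length v
    rw [hlen, hU, hD] at hh
    rw [hh, hx1b] at y1
    refine ⟨by omega, by push_cast at y1; omega, fun z hz1 hz2 => ?_⟩
    obtain ⟨i, hi, e⟩ := hmem' z hz1 hz2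
    obtain ⟨x, -, -, e', y'⟩ := hmem i hi
    have hxz : x = z := by omega
    have := isBallot_iff.1 hv i
    rw [hxz] at y'
    omega
  · rintro ⟨rfl, h1, h2⟩
    set k := 2 * n + n' with hk
    have hlen : ((w.drop a).take k).length = k := by
      rw [List.length_take, List.length_drop]
      omega
    have hh := height_length ((w.drop a).take k)
    rw [hlen, height_take_drop le_rfl, h1] at hh
    have hc := length_eq_count ((w.drop a).take k)
    rw [hlen] at hc
    refine ⟨(w.drop a).take k, ?_, by omega, by omega, a, height w a + 1 + 2 * (j : ℤ), ?_⟩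
    · rw [isBallot_iff]
      intro i
      rcases le_total i k with hi | hi
      · rw [height_take_drop hi]
        have := h2 (a + i) (by omega) (by omega)
        omega
      · rw [height_of_length_le (by rw [hlen]; exact hi), hlen, height_take_drop le_rfl]
        omega
    · ext ⟨x, y⟩
      rw [row, Finset.mem_image, Finset.mem_image]
      constructor
      · rintro ⟨x', hx', he⟩
        rw [Finset.mem_Icc] at hx'
        rw [box, Prod.mk.injEq] at he
        refine ⟨x' - a, by rw [Finset.mem_range]; omega, ?_⟩
        rw [height_take_drop (by omega), Nat.add_sub_cancel' hx'.1, Prod.mk.injEq]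
        exact ⟨he.1, by rw [← he.2]; ring⟩
      · rintro ⟨i, hi, he⟩
        rw [Finset.mem_range] at hi
        rw [height_take_drop (by omega), Prod.mk.injEq] at he
        refine ⟨a + i, by rw [Finset.mem_Icc]; omega, ?_⟩
        rw [box, Prod.mk.injEq]
        exact ⟨he.1, by rw [← he.2]; ring⟩

/-! ### The skew shape -/

section Shape

variable {w mu : List DyckStep} {m : ℕ → ℕ}

theorem mem_skewShape {x : ℕ} {y : ℤ} : (x, y) ∈ skewShape w mu ↔
    (1 ≤ x ∧ x ≤ w.length) ∧ (height w x < y ∧ y < height mu x) ∧ Odd (y - height w x) := by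
  simp only [skewShape, Finset.mem_biUnion, Finset.mem_image, Finset.mem_filter, Finset.mem_Icc,
    Finset.mem_Ioo, Prod.mk.injEq]
  constructor
  · rintro ⟨x', hx, y', hy, rfl, rfl⟩
    exact ⟨hx, hy⟩
  · rintro ⟨hx, hy⟩
    exact ⟨x, hx, y, hy, rfl, rfl⟩

theorem box_mem_skewShape (hm : ∀ x ≤ w.length, height mu x = height w x + 2 * (m x : ℤ))
    {x j : ℕ} : box w x j ∈ skewShape w mu ↔ 1 ≤ x ∧ x ≤ w.length ∧ j < m x := by
  rw [box, mem_skewShape]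
  constructor
  · rintro ⟨⟨h1, h2⟩, h3, -⟩
    have := hm x h2
    exact ⟨h1, h2, by omega⟩
  · rintro ⟨h1, h2, h3⟩
    have := hm x h2
    exact ⟨⟨h1, h2⟩, by omega, by rw [Int.odd_iff]; omega⟩

theorem exists_box_of_mem (hm : ∀ x ≤ w.length, height mu x = height w x + 2 * (m x : ℤ))
    {b : ℕ × ℤ} (hb : b ∈ skewShape w mu) :
    ∃ j, b = box w b.1 j ∧ 1 ≤ b.1 ∧ b.1 ≤ w.length ∧ j < m b.1 := by
  obtain ⟨x, y⟩ := b
  rw [mem_skewShape] at hb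
  obtain ⟨⟨h1, h2⟩, h3, h4⟩ := hb
  have := hm x h2
  obtain ⟨r, hr⟩ := h4
  refine ⟨r.toNat, ?_, h1, h2, ?_⟩
  · rw [box, Prod.mk.injEq]
    refine ⟨rfl, ?_⟩
    dsimp only
    omega
  · dsimp only
    omega

theorem boxBelow_box_succ {x j : ℕ} : boxBelow (box w x (j + 1)) = box w x j := by
  rw [boxBelow, box, box]
  push_cast
  ring_nf

/-! ### Tiles from link numbers -/

/-- The boxes in the row `j` that are linked to the one in column `a` and lie weakly to the right
of it. -/
def tileOf (w : List DyckStep) (l : ℕ → ℕ) (a j : ℕ) : Finset (ℕ × ℤ) :=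
  ((Finset.Icc a w.length).filter fun z => ∀ y ∈ Finset.Ico a z, j < l y).image fun x => box w x j

/-- The leftmost boxes of the tiles. -/
def starts (w : List DyckStep) (m l : ℕ → ℕ) : Finset (Σ _ : ℕ, ℕ) :=
  (Finset.Icc 1 w.length).sigma fun a => Finset.Ico (l (a - 1)) (m a)

/-- The tiles given by the numbers of boxes in the columns and by the link numbers. -/
def partsOf (w : List DyckStep) (m l : ℕ → ℕ) : Finset (Finset (ℕ × ℤ)) :=
  (starts w m l).image fun s => tileOf w l s.1 s.2

/-- The bounds for the link numbers between adjacent columns. -/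
structure LinkBounds (w : List DyckStep) (m l : ℕ → ℕ) : Prop where
  zero : l 0 = 0
  left : ∀ x < w.length, l x ≤ m x
  right : ∀ x < w.length, l x ≤ m (x + 1)
  length : ∀ x, w.length ≤ x → l x = 0

theorem box_mem_tileOf {l : ℕ → ℕ} {a j x i : ℕ} : box w x i ∈ tileOf w l a j ↔
    i = j ∧ a ≤ x ∧ x ≤ w.length ∧ ∀ y, a ≤ y → y < x → j < l y := by
  simp only [tileOf, Finset.mem_image, Finset.mem_filter, Finset.mem_Icc, Finset.mem_Ico, box_inj]
  constructor
  · rintro ⟨x', ⟨h1, h2⟩, rfl, rfl⟩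
    exact ⟨rfl, h1.1, h1.2, fun y hy hy' => h2 y ⟨hy, hy'⟩⟩
  · rintro ⟨rfl, h1, h2, h3⟩
    exact ⟨x, ⟨⟨h1, h2⟩, fun y hy => h3 y hy.1 hy.2⟩, rfl, rfl⟩

theorem mem_starts {l : ℕ → ℕ} {a j : ℕ} : (⟨a, j⟩ : Σ _ : ℕ, ℕ) ∈ starts w m l ↔
    (1 ≤ a ∧ a ≤ w.length) ∧ l (a - 1) ≤ j ∧ j < m a := by
  simp [starts]

theorem exists_run_end {l : ℕ → ℕ} (hl : l w.length = 0) {a : ℕ} (ha : a ≤ w.length) (j : ℕ) :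
    ∃ b, a ≤ b ∧ b ≤ w.length ∧ (∀ y, a ≤ y → y < b → j < l y) ∧ l b ≤ j := by
  have hex : ∃ b, a ≤ b ∧ l b ≤ j := ⟨w.length, ha, by omega⟩
  classical
  refine ⟨Nat.find hex, (Nat.find_spec hex).1, Nat.find_min' hex ⟨ha, by omega⟩,
    fun y hy hy' => ?_, (Nat.find_spec hex).2⟩
  have := Nat.find_min hex hy'
  push Not at this
  exact this hy

theorem exists_run_start {l : ℕ → ℕ} (hl : l 0 = 0) {x : ℕ} (hx : 1 ≤ x) (j : ℕ) :
    ∃ a, 1 ≤ a ∧ a ≤ x ∧ l (a - 1) ≤ j ∧ ∀ y, a ≤ y → y < x → j < l y := by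
  induction x, hx using Nat.le_induction with
  | base => exact ⟨1, le_rfl, le_rfl, by simp [hl], fun y h1 h2 => by omega⟩
  | succ x hx ih =>
    by_cases h : l x ≤ j
    · exact ⟨x + 1, by omega, le_rfl, by simpa using h, fun y h1 h2 => by omega⟩
    · obtain ⟨a, h1, h2, h3, h4⟩ := ih
      refine ⟨a, h1, by omega, h3, fun y hy1 hy2 => ?_⟩
      rcases Nat.lt_or_ge y x with hy | hy
      · exact h4 y hy1 hy
      · obtain rfl : y = x := by omega
        omega

theorem tileOf_eq_row {l : ℕ → ℕ} {a b j : ℕ} (hb : b ≤ w.length)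
    (h : ∀ y, a ≤ y → y < b → j < l y) (hl : l b ≤ j) (hab : a ≤ b) :
    tileOf w l a j = row w a b j := by
  rw [tileOf, row]
  congr 1
  ext z
  rw [Finset.mem_filter, Finset.mem_Icc, Finset.mem_Icc]
  constructor
  · rintro ⟨⟨h1, h2⟩, h3⟩
    refine ⟨h1, ?_⟩
    by_contra hz
    have := h3 b (Finset.mem_Ico.2 ⟨hab, by omega⟩)
    omega
  · rintro ⟨h1, h2⟩
    refine ⟨⟨h1, by omega⟩, fun y hy => ?_⟩
    rw [Finset.mem_Ico] at hy
    exact h y hy.1 (by omega)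

/-- Every box lies in exactly one of the tiles given by the link numbers. -/
theorem LinkBounds.existsUnique {l : ℕ → ℕ} (h : LinkBounds w m l) {x j : ℕ} (hx : 1 ≤ x)
    (hx' : x ≤ w.length) (hj : j < m x) : ∃! t, t ∈ partsOf w m l ∧ box w x j ∈ t := by
  obtain ⟨a, h1, h2, h3, h4⟩ := exists_run_start h.zero hx j
  have hja : j < m a := by
    rcases h2.eq_or_lt with rfl | h2
    · exact hj
    · exact (h4 a le_rfl h2).trans_le (h.left a (by omega))
  refine ⟨tileOf w l a j, ⟨Finset.mem_image.2 ⟨⟨a, j⟩, mem_starts.2 ⟨⟨h1, by omega⟩, h3, hja⟩, rfl⟩,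
    box_mem_tileOf.2 ⟨rfl, h2, hx', h4⟩⟩, ?_⟩
  rintro t ⟨ht, hb⟩
  obtain ⟨⟨a', j'⟩, hs, rfl⟩ := Finset.mem_image.1 ht
  obtain ⟨rfl, g1, g2, g3⟩ := box_mem_tileOf.1 hb
  obtain ⟨⟨k1, k2⟩, k3, k4⟩ := mem_starts.1 hs
  dsimp only at *
  rcases lt_trichotomy a a' with hlt | rfl | hlt
  · have := h4 (a' - 1) (by omega) (by omega)
    omega
  · rfl
  · have := g3 (a - 1) (by omega) (by omega)
    omega

theorem LinkBounds.exists_finpartition {l : ℕ → ℕ} (h : LinkBounds w m l)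
    (hm : ∀ x ≤ w.length, height mu x = height w x + 2 * (m x : ℤ)) :
    ∃ T : Finpartition (skewShape w mu), T.parts = partsOf w m l := by
  classical
  refine ⟨Finpartition.ofExistsUnique (partsOf w m l) ?_ ?_ ?_, rfl⟩
  · intro t ht b hb
    obtain ⟨⟨a, j⟩, hs, rfl⟩ := Finset.mem_image.1 ht
    obtain ⟨⟨k1, k2⟩, k3, k4⟩ := mem_starts.1 hs
    obtain ⟨x, -, rfl⟩ := Finset.mem_image.1 hb
    obtain ⟨-, g1, g2, g3⟩ := box_mem_tileOf.1 hb
    dsimp only at *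
    rw [box_mem_skewShape hm]
    refine ⟨by omega, g2, ?_⟩
    rcases g1.eq_or_lt with rfl | g1
    · exact k4
    · have h1 := g3 (x - 1) (by omega) (by omega)
      have h2 := h.right (x - 1) (by omega)
      rw [Nat.sub_add_cancel (by omega)] at h2
      omega
  · intro b hb
    obtain ⟨j, e, h1, h2, h3⟩ := exists_box_of_mem hm hb
    rw [e]
    exact h.existsUnique h1 h2 h3
  · intro hem
    obtain ⟨⟨a, j⟩, hs, he⟩ := Finset.mem_image.1 hem
    obtain ⟨⟨k1, k2⟩, k3, k4⟩ := mem_starts.1 hs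
    have : box w a j ∈ tileOf w l a j := box_mem_tileOf.2 ⟨rfl, le_rfl, k2, fun y _ _ => by omega⟩
    dsimp only at *
    rw [he] at this
    simp at this

/-- Two boxes which are neighbours in a row lie in the same part. -/
def Linked (w : List DyckStep) {s : Finset (ℕ × ℤ)} (T : Finpartition s) (x j : ℕ) : Prop :=
  ∃ t ∈ T.parts, box w x j ∈ t ∧ box w (x + 1) j ∈ t

/-- The number of pairs of boxes in two adjacent columns that lie in the same part. -/
noncomputable def lnkT (w : List DyckStep) {s : Finset (ℕ × ℤ)} (T : Finpartition s) (x : ℕ) : ℕ :=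
  sInf {j | ¬ Linked w T x j}

theorem lnkT_eq {s : Finset (ℕ × ℤ)} {T : Finpartition s} {l : ℕ → ℕ}
    (h : ∀ x j, j < l x ↔ Linked w T x j) : lnkT w T = l := by
  funext x
  have : {j | ¬ Linked w T x j} = Set.Ici (l x) := by
    ext j
    rw [Set.mem_ofPred_eq, ← h, Set.mem_Ici, not_lt]
  rw [lnkT, this, csInf_Ici]

theorem lt_iff_linked {l : ℕ → ℕ} (h : LinkBounds w m l)
    {T : Finpartition (skewShape w mu)} (hT : T.parts = partsOf w m l) (x j : ℕ) :
    j < l x ↔ Linked w T x j := by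
  constructor
  · intro hj
    have hx : x < w.length := by
      by_contra hx
      have := h.length x (by omega)
      omega
    have hx0 : 1 ≤ x := by
      by_contra hx0
      obtain rfl : x = 0 := by omega
      have := h.zero
      omega
    obtain ⟨t, ⟨ht, hb⟩, -⟩ := h.existsUnique hx0 hx.le (hj.trans_le (h.left x hx))
    refine ⟨t, by rwa [hT], hb, ?_⟩
    obtain ⟨⟨a, j'⟩, hs, rfl⟩ := Finset.mem_image.1 ht
    obtain ⟨rfl, g1, g2, g3⟩ := box_mem_tileOf.1 hb
    dsimp only at *
    refine box_mem_tileOf.2 ⟨rfl, by omega, hx, fun y hy hy' => ?_⟩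
    rcases Nat.lt_or_ge y x with hyx | hyx
    · exact g3 y hy hyx
    · obtain rfl : y = x := by omega
      exact hj
  · rintro ⟨t, ht, hb, hb'⟩
    rw [hT] at ht
    obtain ⟨⟨a, j'⟩, hs, rfl⟩ := Finset.mem_image.1 ht
    obtain ⟨rfl, g1, g2, g3⟩ := box_mem_tileOf.1 hb
    obtain ⟨-, -, -, g4⟩ := box_mem_tileOf.1 hb'
    exact g4 x g1 (Nat.lt_succ_self x)

/-! ### Link numbers of a tiling -/

section Tiling

variable {T : Finpartition (skewShape w mu)}

/-- Induction on the row: cover-inclusiveness moves both boxes down together. Below row `0` there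
are no boxes of the shape, so both translates leave it at the same moment. -/
theorem box_eq_of_linked (hT : IsTilingBI w mu T) (j : ℕ) {t : Finset (ℕ × ℤ)} (ht : t ∈ T.parts) {x j' : ℕ}
    (h1 : box w x j ∈ t) (h2 : box w (x + 1) j' ∈ t) : j' = j := by
  induction j generalizing t j' with
  | zero =>
    rcases hT.cover_inclusive t ht with h | ⟨t', ht', hsub⟩
    · have := h _ h2
      simp only [boxBelow, box] at this
      omega
    · have := T.le ht' (hsub (Finset.mem_image_of_mem _ h1))
      simp only [boxBelow, box, mem_skewShape] at this
      omega
  | succ j ih =>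
    rcases hT.cover_inclusive t ht with h | ⟨t', ht', hsub⟩
    · have := h _ h1
      simp only [boxBelow, box] at this
      omega
    · have g1 := hsub (Finset.mem_image_of_mem _ h1)
      have g2 := hsub (Finset.mem_image_of_mem _ h2)
      rw [boxBelow_box_succ] at g1
      rcases j' with _ | j'
      · have := T.le ht' g2
        simp only [boxBelow, box, mem_skewShape] at this
        omega
      · rw [boxBelow_box_succ] at g2
        rw [ih ht' g1 g2]

theorem linked_of_succ (hT : IsTilingBI w mu T) {x j : ℕ} (h : Linked w T x (j + 1)) :
    Linked w T x j := by
  obtain ⟨t, ht, h1, h2⟩ := h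
  rcases hT.cover_inclusive t ht with h | ⟨t', ht', hsub⟩
  · have := h _ h1
    simp only [boxBelow, box] at this
    omega
  · have g1 := hsub (Finset.mem_image_of_mem _ h1)
    have g2 := hsub (Finset.mem_image_of_mem _ h2)
    rw [boxBelow_box_succ] at g1 g2
    exact ⟨t', ht', g1, g2⟩

theorem lt_lnkT_iff (hm : ∀ x ≤ w.length, height mu x = height w x + 2 * (m x : ℤ))
    (hT : IsTilingBI w mu T) (x j : ℕ) : j < lnkT w T x ↔ Linked w T x j := by
  -- Row `m x` is outside the shape in column `x`, so the set whose infimum defines `lnkT` is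
  -- nonempty.
  have hne : ¬ Linked w T x (m x) := by
    rintro ⟨t, ht, h1, -⟩
    have := (box_mem_skewShape hm).1 (T.le ht h1)
    omega
  constructor
  · intro h
    by_contra hl
    exact Nat.notMem_of_lt_sInf h hl
  · intro h
    by_contra hj
    rw [not_lt] at hj
    have hmem : ¬ Linked w T x (lnkT w T x) := Nat.sInf_mem (s := {j | ¬ Linked w T x j}) ⟨_, hne⟩
    have hdown : ∀ i, lnkT w T x ≤ i → Linked w T x i → Linked w T x (lnkT w T x) := by
      intro i hi
      induction i, hi using Nat.le_induction with
      | base => exact id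
      | succ i hi ih => exact fun h => ih (linked_of_succ hT h)
    exact hmem (hdown j hj h)

theorem linkBounds_lnkT (hm : ∀ x ≤ w.length, height mu x = height w x + 2 * (m x : ℤ))
    (hT : IsTilingBI w mu T) : LinkBounds w m (lnkT w T) := by
  have key : ∀ x j, j < lnkT w T x → (1 ≤ x ∧ j < m x) ∧ (x < w.length ∧ j < m (x + 1)) := by
    intro x j h
    obtain ⟨t, ht, h1, h2⟩ := (lt_lnkT_iff hm hT x j).1 h
    have g1 := (box_mem_skewShape hm).1 (T.le ht h1)
    have g2 := (box_mem_skewShape hm).1 (T.le ht h2)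
    exact ⟨⟨g1.1, g1.2.2⟩, ⟨g2.2.1, g2.2.2⟩⟩
  refine ⟨?_, fun x _ => ?_, fun x _ => ?_, fun x hx => ?_⟩
  · by_contra h
    have := key 0 0 (by omega)
    omega
  · by_contra h
    have := key x (m x) (by omega)
    omega
  · by_contra h
    have := key x (m (x + 1)) (by omega)
    omega
  · by_contra h
    have := key x 0 (by omega)
    omega

theorem exists_row_of_mem (hm : ∀ x ≤ w.length, height mu x = height w x + 2 * (m x : ℤ))
    (hT : IsTilingBI w mu T) {t : Finset (ℕ × ℤ)} (ht : t ∈ T.parts) :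
    ∃ a b j, 1 ≤ a ∧ a ≤ b ∧ b ≤ w.length ∧ j < m a ∧ t = row w a b j := by
  obtain ⟨n, n', v, -, -, -, a, y, he⟩ := hT.tile t ht
  set k := 2 * n + n' with hk
  have hmem : ∀ i, i ≤ k → ∃ j, (a + i, y + height v i) = box w (a + i) j ∧ 1 ≤ a + i ∧
      a + i ≤ w.length ∧ j < m (a + i) ∧ box w (a + i) j ∈ t := by
    intro i hi
    have hi' : (a + i, y + height v i) ∈ t := by
      rw [he, Finset.mem_image]
      exact ⟨i, by rw [Finset.mem_range]; omega, rfl⟩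
    obtain ⟨j, h1, h2, h3, h4⟩ := exists_box_of_mem hm (T.le ht hi')
    exact ⟨j, h1, h2, h3, h4, h1 ▸ hi'⟩
  obtain ⟨j, h1, h2, h3, h4, h5⟩ := hmem 0 (Nat.zero_le _)
  have hflat : ∀ i, i ≤ k → (a + i, y + height v i) = box w (a + i) j ∧ box w (a + i) j ∈ t := by
    intro i
    induction i with
    | zero => exact fun _ => ⟨h1, h5⟩
    | succ i ih =>
      intro hi
      obtain ⟨-, e2⟩ := ih (by omega)
      obtain ⟨j', g1, g2, g3, g4, g5⟩ := hmem (i + 1) hi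
      have := box_eq_of_linked hT j ht e2 g5
      subst this
      exact ⟨g1, g5⟩
  obtain ⟨-, -, -, h6, -, -⟩ := hmem k le_rfl
  refine ⟨a, a + k, j, h2, by omega, h6, h4, ?_⟩
  ext b
  rw [he, Finset.mem_image, row, Finset.mem_image]
  constructor
  · rintro ⟨i, hi, rfl⟩
    rw [Finset.mem_range] at hi
    exact ⟨a + i, by rw [Finset.mem_Icc]; omega, (hflat i (by omega)).1.symm⟩
  · rintro ⟨x, hx, rfl⟩
    rw [Finset.mem_Icc] at hx
    refine ⟨x - a, by rw [Finset.mem_range]; omega, ?_⟩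
    have := (hflat (x - a) (by omega)).1
    rw [Nat.add_sub_cancel' hx.1] at this ⊢
    exact this

theorem row_eq_tileOf (hm : ∀ x ≤ w.length, height mu x = height w x + 2 * (m x : ℤ))
    (hT : IsTilingBI w mu T) {a b j : ℕ} (hab : a ≤ b) (hb : b ≤ w.length)
    (ht : row w a b j ∈ T.parts) :
    row w a b j = tileOf w (lnkT w T) a j ∧ lnkT w T (a - 1) ≤ j := by
  refine ⟨(tileOf_eq_row hb (fun y hy hy' => ?_) ?_ hab).symm, ?_⟩
  · rw [lt_lnkT_iff hm hT]
    exact ⟨_, ht, by rw [box_mem_row]; omega, by rw [box_mem_row]; omega⟩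
  · by_contra h
    obtain ⟨t, ht', h1, h2⟩ := (lt_lnkT_iff hm hT b j).1 (by omega)
    have := T.eq_of_mem_parts ht' ht h1 (by rw [box_mem_row]; omega)
    rw [this, box_mem_row] at h2
    omega
  · by_contra h
    obtain ⟨t, ht', h1, h2⟩ := (lt_lnkT_iff hm hT (a - 1) j).1 (by omega)
    have h0 := ((box_mem_skewShape hm).1 (T.le ht' h1)).1
    rw [Nat.sub_add_cancel (by omega)] at h2
    have := T.eq_of_mem_parts ht' ht h2 (by rw [box_mem_row]; omega)
    rw [this, box_mem_row] at h1
    omega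

/-- The link numbers determine the tiling. Each part is a maximal run, and a run without a
corresponding part would share a box with some other part. -/
theorem parts_eq_partsOf (hm : ∀ x ≤ w.length, height mu x = height w x + 2 * (m x : ℤ))
    (hT : IsTilingBI w mu T) : T.parts = partsOf w m (lnkT w T) := by
  have hsub : T.parts ⊆ partsOf w m (lnkT w T) := by
    intro t ht
    obtain ⟨a, b, j, h1, h2, h3, h4, rfl⟩ := exists_row_of_mem hm hT ht
    obtain ⟨e, h5⟩ := row_eq_tileOf hm hT h2 h3 ht
    rw [e]
    exact Finset.mem_image.2 ⟨⟨a, j⟩, mem_starts.2 ⟨⟨h1, by omega⟩, h5, h4⟩, rfl⟩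
  refine Finset.Subset.antisymm hsub fun t ht => ?_
  obtain ⟨⟨a, j⟩, hs, rfl⟩ := Finset.mem_image.1 ht
  obtain ⟨⟨k1, k2⟩, k3, k4⟩ := mem_starts.1 hs
  have hb : box w a j ∈ tileOf w (lnkT w T) a j :=
    box_mem_tileOf.2 ⟨rfl, le_rfl, k2, fun y _ _ => by omega⟩
  obtain ⟨t, ht', hbt⟩ := T.exists_mem ((box_mem_skewShape hm).2 ⟨k1, k2, k4⟩)
  have := ((linkBounds_lnkT hm hT).existsUnique k1 k2 k4).unique ⟨ht, hb⟩ ⟨hsub ht', hbt⟩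
  dsimp only at this ⊢
  rwa [this]

end Tiling

end Shape


/-! ### Maximal runs of linked boxes, and the tile conditions as conditions on link numbers. -/

section Runs

variable {w mu : List DyckStep} {m l : ℕ → ℕ}

/-- The boxes of the row `j` in the columns from `a` to `b` form a maximal run of linked boxes. -/
structure IsRun (w : List DyckStep) (m l : ℕ → ℕ) (a b j : ℕ) : Prop where
  pos : 1 ≤ a
  le : a ≤ b
  le_length : b ≤ w.length
  start : l (a - 1) ≤ j
  lt : j < m a
  link : ∀ y, a ≤ y → y < b → j < l y
  stops : l b ≤ j

theorem mem_partsOf_iff (h : LinkBounds w m l) {t : Finset (ℕ × ℤ)} :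
    t ∈ partsOf w m l ↔ ∃ a b j, IsRun w m l a b j ∧ t = row w a b j := by
  rw [partsOf, Finset.mem_image]
  constructor
  · rintro ⟨⟨a, j⟩, hs, rfl⟩
    obtain ⟨⟨k1, k2⟩, k3, k4⟩ := mem_starts.1 hs
    obtain ⟨b, h1, h2, h3, h4⟩ := exists_run_end (h.length _ le_rfl) k2 j
    exact ⟨a, b, j, ⟨k1, h1, h2, k3, k4, h3, h4⟩, tileOf_eq_row h2 h3 h4 h1⟩
  · rintro ⟨a, b, j, hr, rfl⟩
    exact ⟨⟨a, j⟩, mem_starts.2 ⟨⟨hr.pos, hr.le.trans hr.le_length⟩, hr.start, hr.lt⟩,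
      tileOf_eq_row hr.le_length hr.link hr.stops hr.le⟩

theorem LinkBounds.exists_run (h : LinkBounds w m l) {x j : ℕ} (hx : 1 ≤ x) (hx' : x ≤ w.length)
    (hj : j < m x) : ∃ a b, IsRun w m l a b j ∧ a ≤ x ∧ x ≤ b := by
  obtain ⟨a, h1, h2, h3, h4⟩ := exists_run_start h.zero hx j
  obtain ⟨b, g1, g2, g3, g4⟩ := exists_run_end (h.length _ le_rfl) hx' j
  refine ⟨a, b, ⟨h1, h2.trans g1, g2, h3, ?_, fun y hy hy' => ?_, g4⟩, h2, g1⟩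
  · rcases h2.eq_or_lt with rfl | h2
    · exact hj
    · exact (h4 a le_rfl h2).trans_le (h.left a (by omega))
  · rcases Nat.lt_or_ge y x with hyx | hyx
    · exact h4 y hy hyx
    · exact g3 y hyx hy'

theorem LinkBounds.exists_run_of_lt (h : LinkBounds w m l) {x j : ℕ} (hj : j < l x) :
    ∃ a b, IsRun w m l a b j ∧ a ≤ x ∧ x < b := by
  have hx : 1 ≤ x := by
    by_contra hx
    obtain rfl : x = 0 := by omega
    have := h.zero
    omega
  have hx' : x < w.length := by
    by_contra hx'
    have := h.length x (by omega)
    omega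
  obtain ⟨a, b, hr, h1, h2⟩ := h.exists_run hx hx'.le (hj.trans_le (h.left x hx'))
  refine ⟨a, b, hr, h1, h2.lt_of_ne ?_⟩
  rintro rfl
  have := hr.stops
  omega

/-- Each run has the shape of a ballot tile that is anchored if it is not a Dyck tile. -/
def RunsOK (w : List DyckStep) (m l : ℕ → ℕ) : Prop :=
  ∀ a b j, IsRun w m l a b j →
    (∀ z, a ≤ z → z ≤ b → height w a ≤ height w z) ∧ (height w b = height w a ∨ b = w.length)

theorem RunsOK.of_tiling {T : Finpartition (skewShape w mu)} (hT : IsTilingBI w mu T)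
    (h : LinkBounds w m l) (hp : T.parts = partsOf w m l) : RunsOK w m l := by
  intro a b j hr
  have ht : row w a b j ∈ T.parts := by
    rw [hp, mem_partsOf_iff h]
    exact ⟨a, b, j, hr, rfl⟩
  obtain ⟨n, n', hn⟩ := hT.tile _ ht
  obtain ⟨h1, h2, h3⟩ := (isTile_row_iff hr.le hr.le_length).1 hn
  refine ⟨h3, ?_⟩
  rcases Nat.eq_zero_or_pos n' with rfl | hn'
  · exact Or.inl (by simpa using h2)
  · obtain ⟨⟨x, y⟩, hb, hx⟩ := hT.anchored _ ht n n' hn' hn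
    rw [row, Finset.mem_image] at hb
    obtain ⟨x', hx', he⟩ := hb
    rw [box, Prod.mk.injEq] at he
    rw [Finset.mem_Icc] at hx'
    have := hr.le_length
    dsimp only at hx
    exact Or.inr (by omega)

/-- If the link number dropped from an open up step to a later step inside it, a run crossing the up
step would end above its starting height before the last column. If a down step had a larger link
number than its partner, a run crossing it would start inside the pair and descend below its
starting height. -/
theorem RunsOK.linkOK (hR : RunsOK w m l) (hb : IsBallot w) (h : LinkBounds w m l) :
    LinkOK w l := by
  have core : ∀ x p, x < p → p < w.length → (∀ z, x < z → z ≤ p → height w x < height w z) →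
      l x ≤ l p := by
    intro x p hxp hp hz
    by_contra hl
    obtain ⟨a, b, hr, h1, h2⟩ := h.exists_run_of_lt (x := x) (j := l p) (by omega)
    obtain ⟨g1, g2⟩ := hR a b _ hr
    have hbp : b ≤ p := by
      by_contra hbp
      have := hr.link p (by omega) (by omega)
      omega
    have := g1 x h1 h2.le
    have := hz b h2 hbp
    omega
  refine ⟨fun p hp => ?_, fun p hp => ?_⟩
  · by_cases hpos : 0 < height w p
    · obtain ⟨x, h1, h2, h3, h4, h5⟩ := exists_open (l := l) hpos
      rw [h5, List.headD_cons]
      exact core x p h1 (lt_length_of_getElem? hp) h4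
    · rw [stk_eq_nil hb hpos]
      exact Nat.zero_le _
  · have hd := height_down hp
    have h0 := isBallot_iff.1 hb (p + 1)
    obtain ⟨x, h1, h2, h3, h4, h5⟩ := exists_open (w := w) (l := l) (p := p) (by omega)
    rw [h5, List.headD_cons]
    refine le_antisymm ?_ (core x p h1 (lt_length_of_getElem? hp) h4)
    by_contra hl
    obtain ⟨a, b, hr, g1, g2⟩ := h.exists_run_of_lt (x := p) (j := l x) (by omega)
    have hxa : x < a := by
      by_contra hxa
      have := hr.link x (by omega) (by omega)
      omega
    have := (hR a b _ hr).1 (p + 1) (by omega) g2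
    have := h4 a hxa g1
    omega

/-- A down step leading below the starting height has its partner to the left of the run, so its
link number is at most the one just before the run and the run cannot cross it. A run that ends
strictly higher, but before the last column, has crossed a step that is still open at its end, hence
it could be continued. -/
theorem LinkOK.runsOK (hL : LinkOK w l) (hb : IsBallot w) : RunsOK w m l := by
  intro a b j hr
  have h1 : ∀ z, a ≤ z → z ≤ b → ∀ y, a ≤ y → y ≤ z → height w a ≤ height w y := by
    intro z haz
    induction z, haz using Nat.le_induction with
    | base =>
      intro _ y h1 h2
      obtain rfl : y = a := by omega
      exact le_rfl
    | succ z haz ih =>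
      intro hzb y hy1 hy2
      have ih := ih (by omega)
      rcases Nat.lt_or_ge z y with hzy | hzy
      · obtain rfl : y = z + 1 := by omega
        by_contra hlt
        have hz := ih z haz le_rfl
        have hr' := hr.le_length
        rcases step_cases (w := w) (x := z) (by omega) with hw | hw
        · have := height_up hw
          omega
        · have hd := height_down hw
          have hp := hr.pos
          have := hL.le_inside_down hb hw (y := a - 1) (by omega) fun z' hz1 hz2 => by
            have := ih z' (by omega) hz2
            omega
          have := hr.link z haz (by omega)
          have := hr.start
          omega
      · exact ih y hy1 hzy
  refine ⟨fun z hz1 hz2 => h1 z hz1 hz2 z hz1 le_rfl, ?_⟩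
  by_contra hcon
  push Not at hcon
  have hle := h1 b hr.le le_rfl b hr.le le_rfl
  obtain ⟨u, g1, g2, g3, g4⟩ := exists_last_height hr.le hle
  have hub : u < b := by
    refine g2.lt_of_ne ?_
    rintro rfl
    exact hcon.1 g3
  have hr' := hr.le_length
  have hu : w[u]? = some DyckStep.U :=
    height_up_of_forall_lt (by have := g4 (u + 1) (by omega) (by omega); omega)
  have := hL.le_inside_up hb hu hub.le (by omega) fun z hz1 hz2 => by
    have := g4 z hz1 hz2
    omega
  have := hr.link u g1 hub
  have := hr.stops
  omega

/-! ### Unpaired up steps -/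

/-- The step at `u` is an unpaired up step. -/
def IsUnpaired (w : List DyckStep) (u : ℕ) : Prop :=
  w[u]? = some DyckStep.U ∧ ∀ z, u < z → z ≤ w.length → height w u < height w z

/-- No down step precedes immediately an unpaired up step with an odd number, where the unpaired
up steps are numbered from right to left. -/
def NoArrowWord (w : List DyckStep) : Prop :=
  ∀ u, IsUnpaired w (u + 1) → Odd (height w w.length - height w (u + 1)) →
    w[u]? = some DyckStep.U

theorem IsUnpaired.lt_length {u : ℕ} (hu : IsUnpaired w u) : u < w.length :=
  lt_length_of_getElem? hu.1

theorem endOK_iff_forall_append (st : List ℕ) : EndOK st ↔ ∀ t a s, st = t ++ a :: s →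
    (Even t.length → Even a) ∧ (Odd t.length → a = s.headD 0) := by
  induction st using EndOK.induct with
  | case1 => simp [EndOK]
  | case2 a =>
    rw [EndOK]
    constructor
    · rintro ha t b s h
      rcases t with _ | ⟨c, t⟩
      · simp at h
        simp [← h.1, ha]
      · simp at h
    · intro h
      exact (h [] a [] rfl).1 (by simp)
  | case3 a b st ih =>
    rw [EndOK, ih]
    constructor
    · rintro ⟨ha, hb, hst⟩ t c s h
      rcases t with _ | ⟨d, _ | ⟨e, t⟩⟩
      · simp at h
        simp [← h.1, ha]
      · simp only [List.cons_append, List.nil_append, List.cons.injEq] at h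
        obtain ⟨-, rfl, rfl⟩ := h
        simp [hb]
      · simp only [List.cons_append, List.cons.injEq] at h
        have := hst t c s h.2.2
        simpa [Nat.even_add_one, Nat.odd_add_one] using this
    · intro h
      refine ⟨(h [] a (b :: st) rfl).1 (by simp), (h [a] b st rfl).2 (by simp), fun t c s hs => ?_⟩
      have := h (a :: b :: t) c s (by rw [hs]; rfl)
      simpa [Nat.even_add_one, Nat.odd_add_one] using this

theorem exists_open_of_stk_eq {p : ℕ} (hb : IsBallot w) {t s : List ℕ} {a : ℕ}
    (h : stk w l p = t ++ a :: s) : ∃ u, u < p ∧ w[u]? = some DyckStep.U ∧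
      (∀ z, u < z → z ≤ p → height w u < height w z) ∧ a = l u ∧ s = stk w l u ∧
      (t.length : ℤ) = height w p - height w u - 1 := by
  induction t generalizing p with
  | nil =>
    have hl := length_stk (l := l) hb p
    rw [h, List.nil_append, List.length_cons] at hl
    obtain ⟨u, h1, h2, h3, h4, h5⟩ := exists_open (w := w) (l := l) (p := p) (by omega)
    rw [h5, List.nil_append, List.cons.injEq] at h
    exact ⟨u, h1, h2, h4, h.1.symm, h.2.symm, by simp; omega⟩
  | cons c t ih =>
    have hl := length_stk (l := l) hb p
    rw [h, List.cons_append, List.length_cons] at hl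
    obtain ⟨x, h1, h2, h3, h4, h5⟩ := exists_open (w := w) (l := l) (p := p) (by omega)
    rw [h5, List.cons_append, List.cons.injEq] at h
    obtain ⟨u, g1, g2, g3, g4, g5, g6⟩ := ih h.2
    refine ⟨u, by omega, g2, fun z hz1 hz2 => ?_, g4, g5, by simp; omega⟩
    rcases Nat.lt_or_ge x z with hz | hz
    · have := g3 x g1 le_rfl
      have := h4 z hz hz2
      omega
    · exact g3 z hz1 hz

/-- The number of an unpaired up step `u`, counted from the right, is `height w w.length - height w
u`; its position in the stack, counted from `0`, is one less. -/
theorem endOK_iff (hb : IsBallot w) : EndOK (stk w l w.length) ↔ ∀ u, IsUnpaired w u →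
    (Odd (height w w.length - height w u) → Even (l u)) ∧
    (Even (height w w.length - height w u) → l u = (stk w l u).headD 0) := by
  rw [endOK_iff_forall_append]
  have par : ∀ (t : ℕ) (d : ℤ), (t : ℤ) = d - 1 → (Even t ↔ Odd d) ∧ (Odd t ↔ Even d) := by
    intro t d h
    rw [Nat.even_iff, Nat.odd_iff, Int.odd_iff, Int.even_iff]
    omega
  constructor
  · intro h u hu
    obtain ⟨t, ht, hl⟩ := stk_of_open (l := l) hb hu.1 hu.lt_length hu.2
    obtain ⟨p1, p2⟩ := par _ _ hl
    rw [← p1, ← p2]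
    exact h t _ _ ht
  · intro h t a s hst
    obtain ⟨u, h1, h2, h3, rfl, rfl, h6⟩ := exists_open_of_stk_eq hb hst
    obtain ⟨p1, p2⟩ := par _ _ h6
    rw [p1, p2]
    exact h u ⟨h2, h3⟩

theorem exists_length_eq {a b n' : ℕ} (hab : a ≤ b) (hb : b ≤ w.length)
    (h : height w b = height w a + n') : ∃ n, b = a + (2 * n + n') := by
  have hlen : ((w.drop a).take (b - a)).length = b - a := by
    rw [List.length_take, List.length_drop]
    omega
  have hh := height_length ((w.drop a).take (b - a))
  rw [hlen, height_take_drop le_rfl, Nat.add_sub_cancel' hab, h] at hh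
  have hc := length_eq_count ((w.drop a).take (b - a))
  exact ⟨((w.drop a).take (b - a)).count DyckStep.D, by omega⟩

theorem IsUnpaired.le_link {u y : ℕ} (hu : IsUnpaired w u) (hL : LinkOK w l) (hb : IsBallot w)
    (huy : u ≤ y) (hy : y < w.length) : l u ≤ l y :=
  hL.le_inside_up hb hu.1 huy hy fun z hz1 hz2 => hu.2 z hz1 (by omega)

theorem IsUnpaired.prev {u v : ℕ} (hu : IsUnpaired w u) (hv : w[v]? = some DyckStep.U)
    (h : height w v < height w u) (hz : ∀ z, v < z → z ≤ u → height w v < height w z) :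
    IsUnpaired w v := by
  refine ⟨hv, fun z hz1 hz2 => ?_⟩
  rcases Nat.lt_or_ge u z with hz' | hz'
  · exact h.trans (hu.2 z hz' hz2)
  · exact hz z hz1 hz'

-- Such tiles reach the last column, so their length makes them start in column `u`. Beyond an
-- unpaired step link numbers never fall below `l u`, so there is one such tile for each row `j`
-- with `l (u - 1) ≤ j < l u`.
open Classical in
theorem card_filter_isTile {u n n' : ℕ} (hu : IsUnpaired w u) (hu1 : 1 ≤ u) (hL : LinkOK w l)
    (hb : IsBallot w) (h : LinkBounds w m l) (hn : w.length = u + (2 * n + n'))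
    (hh : height w w.length = height w u + n') :
    ((partsOf w m l).filter (IsTile n n')).card = l u - l (u - 1) := by
  have hn' : 0 < n' := by
    have := hu.2 _ hu.lt_length le_rfl
    omega
  have : (partsOf w m l).filter (IsTile n n') =
      (Finset.Ico (l (u - 1)) (l u)).image (row w u w.length) := by
    ext t
    rw [Finset.mem_filter, mem_partsOf_iff h, Finset.mem_image]
    constructor
    · rintro ⟨⟨a, b, j, hr, rfl⟩, ht⟩
      obtain ⟨h1, h2, h3⟩ := (isTile_row_iff hr.le hr.le_length).1 ht
      have hbL : b = w.length := by
        rcases (hL.runsOK hb a b j hr).2 with h4 | h4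
        · omega
        · exact h4
      obtain rfl : a = u := by omega
      refine ⟨j, Finset.mem_Ico.2 ⟨hr.start, hr.link a le_rfl ?_⟩, by rw [hbL]⟩
      rw [hbL]
      exact hu.lt_length
    · rintro ⟨j, hj, rfl⟩
      rw [Finset.mem_Ico] at hj
      refine ⟨⟨u, w.length, j, ⟨hu1, hu.lt_length.le, le_rfl, hj.1,
        hj.2.trans_le (h.left u hu.lt_length), fun y hy hy' => ?_, ?_⟩, rfl⟩, ?_⟩
      · exact hj.2.trans_le (hu.le_link hL hb hy hy')
      · rw [h.length _ le_rfl]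
        exact Nat.zero_le _
      · rw [isTile_row_iff hu.lt_length.le le_rfl]
        refine ⟨hn, hh, fun z hz1 hz2 => ?_⟩
        rcases hz1.eq_or_lt with rfl | hz1
        · exact le_rfl
        · exact (hu.2 z hz1 hz2).le
  rw [this, Finset.card_image_of_injOn, Nat.card_Ico]
  intro j _ j' _ he
  exact (row_inj hu.lt_length.le he).2.2

/-- The link number of an unpaired up step with an even number is even if the next unpaired up
step to the left has the same link number, which is even. -/
theorem even_of_eq_headD (hb : IsBallot w) {v : ℕ} (hv : IsUnpaired w v)
    (hev : Even (height w w.length - height w v)) (hl : l v = (stk w l v).headD 0)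
    (ih : ∀ x < v, IsUnpaired w x → Odd (height w w.length - height w x) → Even (l x)) :
    Even (l v) := by
  rw [hl]
  by_cases hpos : 0 < height w v
  · obtain ⟨x, h1, h2, h3, h4, h5⟩ := exists_open (l := l) hpos
    rw [h5, List.headD_cons]
    refine ih x h1 (hv.prev h2 (by omega) h4) ?_
    rw [Int.odd_iff]
    rw [Int.even_iff] at hev
    omega
  · rw [stk_eq_nil hb hpos]
    simp

theorem isUnpaired_pred {u : ℕ} (hu : IsUnpaired w (u + 1)) (hw : w[u]? = some DyckStep.U) :
    IsUnpaired w u := by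
  have := height_up hw
  refine hu.prev hw (by omega) fun z hz1 hz2 => ?_
  obtain rfl : z = u + 1 := by omega
  omega

/-- Induction from left to right over the unpaired up steps. At an odd-numbered `u` the preceding
step is unpaired and has an even link number, and the even number of tiles is `l u - l (u - 1)`. At
an even-numbered `u`, a link number larger than that of the previous open step would create a tile
with `n'` even and positive. -/
theorem endOK_of_tiling {T : Finpartition (skewShape w mu)} (hT : IsTilingBI w mu T)
    (hb : IsBallot w) (hN : NoArrowWord w) (h : LinkBounds w m l)
    (hp : T.parts = partsOf w m l) : EndOK (stk w l w.length) := by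
  have hR := RunsOK.of_tiling hT h hp
  have hL := hR.linkOK hb h
  rw [endOK_iff hb]
  intro u
  induction u using Nat.strong_induction_on with
  | _ u ih =>
  intro hu
  constructor
  · intro ho
    rcases u with _ | v
    · rw [h.zero]
      exact Even.zero
    have hw := hN v hu ho
    have hv := isUnpaired_pred hu hw
    have hhv := height_up hw
    have hev : Even (height w w.length - height w v) := by
      rw [Int.even_iff]
      rw [Int.odd_iff] at ho
      omega
    have h1 := even_of_eq_headD hb hv hev ((ih v (by omega) hv).2 hev)
      fun x hx hux => (ih x (by omega) hux).1
    have hle : l v ≤ l (v + 1) := by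
      have := hL.up _ hu.1
      rwa [stk_up hw, List.headD_cons] at this
    have hpos := hu.2 _ hu.lt_length le_rfl
    obtain ⟨n', hn'⟩ := Int.eq_ofNat_of_zero_le (sub_nonneg.2 hpos.le)
    have hh : height w w.length = height w (v + 1) + n' := by omega
    obtain ⟨n, hn⟩ := exists_length_eq hu.lt_length.le le_rfl hh
    have hc := card_filter_isTile hu (by omega) hL hb h hn hh
    rw [hn', Int.odd_coe_nat] at ho
    have he := hT.even_of_odd n n' ho
    rw [hp, hc, Nat.add_sub_cancel, Nat.even_sub hle] at he
    exact he.2 h1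
  · intro hev
    refine le_antisymm ?_ (hL.up u hu.1)
    by_contra hlt
    obtain ⟨a, b, hr, h1, h2⟩ := h.exists_run_of_lt (x := u) (j := (stk w l u).headD 0) (by omega)
    have hbL : b = w.length := by
      refine le_antisymm hr.le_length ?_
      by_contra hbL
      have := hu.le_link hL hb h2.le (by omega)
      have := hr.stops
      omega
    have hau := (hR a b _ hr).1 u h1 h2.le
    -- A run starting lower would cross the last open up step `x` before `u`; but it lies in row `l
    -- x`, which is not linked across `x`.
    have hau' : height w a = height w u := by
      refine le_antisymm hau ?_
      by_contra hlt'
      have := isBallot_iff.1 hb a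
      obtain ⟨x, g1, g2, g3, g4, g5⟩ := exists_open (w := w) (l := l) (p := u) (by omega)
      rw [g5, List.headD_cons] at hr
      rcases Nat.lt_or_ge x a with hxa | hxa
      · have := g4 a hxa h1
        omega
      · have := hr.link x hxa (by omega)
        omega
    have ht : row w a b ((stk w l u).headD 0) ∈ T.parts := by
      rw [hp, mem_partsOf_iff h]
      exact ⟨a, b, _, hr, rfl⟩
    obtain ⟨n, n', hn⟩ := hT.tile _ ht
    obtain ⟨-, k2, -⟩ := (isTile_row_iff hr.le hr.le_length).1 hn
    rw [hbL, hau'] at k2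
    have hpos := hu.2 _ hu.lt_length le_rfl
    refine hT.none_of_even n n' ?_ (by omega) _ ht hn
    rw [k2, add_sub_cancel_left, Int.even_coe_nat] at hev
    exact hev

/-- The last visit to the starting height is an unpaired up step, whose number from the right is
`n'`. -/
theorem exists_unpaired_of_run (hL : LinkOK w l) (hb : IsBallot w) {a b j n n' : ℕ}
    (hr : IsRun w m l a b j) (ht : IsTile n n' (row w a b j)) (hn' : 0 < n') :
    b = w.length ∧ ∃ u, a ≤ u ∧ IsUnpaired w u ∧ height w u = height w a ∧
      height w w.length = height w u + n' := by
  obtain ⟨h1, h2, h3⟩ := (isTile_row_iff hr.le hr.le_length).1 ht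
  have hbL : b = w.length := by
    rcases (hL.runsOK hb a b j hr).2 with h4 | h4
    · omega
    · exact h4
  subst hbL
  obtain ⟨u, g1, g2, g3, g4⟩ := exists_last_height (w := w) hr.le (by omega)
  have hul : u < w.length := by
    refine g2.lt_of_ne ?_
    rintro rfl
    omega
  refine ⟨rfl, u, g1, ⟨height_up_of_forall_lt ?_, fun z hz1 hz2 => ?_⟩, g3, by omega⟩
  · have := g4 (u + 1) (by omega) (by omega)
    omega
  · have := g4 z hz1 hz2
    omega

/-- For odd `n'` all tiles of one size start at the same unpaired up step, and their number is a
difference of two even link numbers. For even `n'` the tile would cross a step having the link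
number of the previous open up step, so it would extend further to the left; if there is no such
step, the link number is `0`. -/
theorem isTilingBI_of_cfg {T : Finpartition (skewShape w mu)} (hb : IsBallot w)
    (hN : NoArrowWord w) (h : LinkBounds w m l) (hp : T.parts = partsOf w m l)
    (hL : LinkOK w l) (hE : EndOK (stk w l w.length)) : IsTilingBI w mu T := by
  have hR : RunsOK w m l := hL.runsOK hb
  rw [endOK_iff hb] at hE
  refine ⟨fun t ht => ?_, fun t ht n n' hn' htile => ?_, fun t ht => ?_, fun n n' ho => ?_,
    fun n n' hev hn' t ht htile => ?_⟩
  · rw [hp, mem_partsOf_iff h] at ht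
    obtain ⟨a, b, j, hr, rfl⟩ := ht
    obtain ⟨g1, -⟩ := hR a b j hr
    obtain ⟨n', hn'⟩ := Int.eq_ofNat_of_zero_le (sub_nonneg.2 (g1 b hr.le le_rfl))
    have hh : height w b = height w a + n' := by omega
    obtain ⟨n, hn⟩ := exists_length_eq hr.le hr.le_length hh
    exact ⟨n, n', (isTile_row_iff hr.le hr.le_length).2 ⟨hn, hh, g1⟩⟩
  · rw [hp, mem_partsOf_iff h] at ht
    obtain ⟨a, b, j, hr, rfl⟩ := ht
    obtain ⟨rfl, -⟩ := exists_unpaired_of_run hL hb hr htile hn'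
    exact ⟨box w w.length j, box_mem_row.2 ⟨rfl, hr.le, le_rfl⟩, rfl⟩
  · rw [hp, mem_partsOf_iff h] at ht
    obtain ⟨a, b, j, hr, rfl⟩ := ht
    rcases j with _ | j
    · left
      intro c hc
      rw [row, Finset.mem_image] at hc
      obtain ⟨x, -, rfl⟩ := hc
      simp only [boxBelow, box]
      omega
    · right
      have hlt := hr.lt
      obtain ⟨a', b', hr', h1, h2⟩ := h.exists_run (j := j) hr.pos (hr.le.trans hr.le_length)
        (by omega)
      refine ⟨row w a' b' j, by rw [hp, mem_partsOf_iff h]; exact ⟨a', b', j, hr', rfl⟩, ?_⟩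
      intro c hc
      obtain ⟨c', hc', rfl⟩ := Finset.mem_image.1 hc
      rw [row, Finset.mem_image] at hc'
      obtain ⟨x, hx, rfl⟩ := hc'
      rw [Finset.mem_Icc] at hx
      rw [boxBelow_box_succ, box_mem_row]
      have hbb : b ≤ b' := by
        by_contra hbb
        have := hr.link b' (by omega) (by omega)
        have := hr'.stops
        omega
      omega
  · classical
    rw [hp]
    rcases Finset.eq_empty_or_nonempty ((partsOf w m l).filter (IsTile n n')) with he | ⟨t, ht⟩
    · rw [he]
      simp
    · rw [Finset.mem_filter, mem_partsOf_iff h] at ht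
      obtain ⟨⟨a, b, j, hr, rfl⟩, ht⟩ := ht
      obtain ⟨rfl, u, h1, h2, h3, h4⟩ := exists_unpaired_of_run hL hb hr ht ho.pos
      have hou : Odd (height w w.length - height w u) := by
        rw [h4, add_sub_cancel_left, Int.odd_coe_nat]
        exact ho
      have hpos := hr.pos
      obtain ⟨v, rfl⟩ : ∃ v, u = v + 1 := ⟨u - 1, by omega⟩
      have hw := hN v h2 hou
      have hhv := height_up hw
      -- The run cannot begin further left, since it would then contain the lower column `v`.
      obtain rfl : a = v + 1 := by
        refine le_antisymm h1 ?_
        by_contra hav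
        have := (hR a _ j hr).1 v (by omega) (by have := h2.lt_length; omega)
        omega
      obtain ⟨k1, -, -⟩ := (isTile_row_iff hr.le hr.le_length).1 ht
      rw [card_filter_isTile h2 (by omega) hL hb h k1 h4]
      have hv := isUnpaired_pred h2 hw
      have hev : Even (height w w.length - height w v) := by
        rw [Int.even_iff]
        rw [Int.odd_iff] at hou
        omega
      rw [Nat.add_sub_cancel]
      exact ((hE _ h2).1 hou).tsub (even_of_eq_headD hb hv hev ((hE v hv).2 hev)
        fun x _ hx => (hE x hx).1)
  · rw [hp, mem_partsOf_iff h] at ht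
    obtain ⟨a, b, j, hr, rfl⟩ := ht
    obtain ⟨rfl, u, h1, h2, h3, h4⟩ := exists_unpaired_of_run hL hb hr htile hn'
    have hev' : Even (height w w.length - height w u) := by
      rw [h4, add_sub_cancel_left, Int.even_coe_nat]
      exact hev
    have hl := (hE u h2).2 hev'
    have hj := hr.link u h1 h2.lt_length
    by_cases hpos : 0 < height w u
    · obtain ⟨x, g1, g2, g3, g4, g5⟩ := exists_open (l := l) hpos
      rw [g5, List.headD_cons] at hl
      have hxa : x < a := by
        by_contra hxa
        have := (hR a _ j hr).1 x (by omega) (by have := h2.lt_length; omega)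
        omega
      have := hL.le_inside_up hb g2 (y := a - 1) (by omega) (by have := hr.le; omega)
        fun z hz1 hz2 => g4 z hz1 (by omega)
      have := hr.start
      omega
    · rw [stk_eq_nil hb hpos] at hl
      simp at hl
      omega

end Runs


/-! ### The statistic of a tiling -/

section Art

variable {w mu : List DyckStep} {m l : ℕ → ℕ}

theorem card_skewShape (hm : ∀ x ≤ w.length, height mu x = height w x + 2 * (m x : ℤ)) :
    (skewShape w mu).card = ∑ x ∈ Finset.Icc 1 w.length, m x := by
  have : skewShape w mu = ((Finset.Icc 1 w.length).sigma fun x => Finset.range (m x)).image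
      fun s => box w s.1 s.2 := by
    ext b
    rw [Finset.mem_image]
    constructor
    · intro hb
      obtain ⟨j, e, h1, h2, h3⟩ := exists_box_of_mem hm hb
      exact ⟨⟨b.1, j⟩, by simp [h1, h2, h3], e.symm⟩
    · rintro ⟨⟨x, j⟩, hs, rfl⟩
      simp at hs
      exact (box_mem_skewShape hm).2 ⟨hs.1.1, hs.1.2, hs.2⟩
  rw [this, Finset.card_image_of_injective, Finset.card_sigma]
  · simp
  · rintro ⟨x, j⟩ ⟨x', j'⟩ he
    obtain ⟨rfl, rfl⟩ := box_inj.1 he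
    rfl

theorem card_partsOf : (partsOf w m l).card = ∑ x ∈ Finset.Icc 1 w.length, (m x - l (x - 1)) := by
  rw [partsOf, Finset.card_image_of_injOn, starts, Finset.card_sigma]
  · simp
  · rintro ⟨a, j⟩ hs ⟨a', j'⟩ hs' he
    obtain ⟨⟨h1, h2⟩, h3, h4⟩ := mem_starts.1 hs
    obtain ⟨⟨g1, g2⟩, g3, g4⟩ := mem_starts.1 hs'
    dsimp only at he
    have k1 : box w a j ∈ tileOf w l a' j' := by
      rw [← he, box_mem_tileOf]
      exact ⟨rfl, le_rfl, h2, fun y _ _ => by omega⟩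
    have k2 : box w a' j' ∈ tileOf w l a j := by
      rw [he, box_mem_tileOf]
      exact ⟨rfl, le_rfl, g2, fun y _ _ => by omega⟩
    rw [box_mem_tileOf] at k1 k2
    obtain rfl : a = a' := by omega
    obtain rfl : j = j' := by omega
    rfl

-- Every tile that is not a Dyck tile runs to the last column across the rightmost unpaired up step
-- `u`, and each of the `l u` rows linked there contains exactly one.
open Classical in
theorem card_filter_not_dyck {T : Finpartition (skewShape w mu)} (hT : IsTilingBI w mu T)
    (hm : ∀ x ≤ w.length, height mu x = height w x + 2 * (m x : ℤ))
    (hb : IsBallot w) (h : LinkBounds w m l) (hp : T.parts = partsOf w m l) (hL : LinkOK w l) :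
    (T.parts.filter fun t => ¬ ∃ n, IsTile n 0 t).card = (stk w l w.length).headD 0 := by
  have hrun : ∀ t ∈ T.parts, (¬ ∃ n, IsTile n 0 t) → ∃ a b j n n', IsRun w m l a b j ∧
      t = row w a b j ∧ 0 < n' ∧ IsTile n n' t := by
    intro t ht hnd
    obtain ⟨n, n', hn⟩ := hT.tile t ht
    rw [hp, mem_partsOf_iff h] at ht
    obtain ⟨a, b, j, hr, rfl⟩ := ht
    refine ⟨a, b, j, n, n', hr, rfl, Nat.pos_of_ne_zero ?_, hn⟩
    rintro rfl
    exact hnd ⟨n, hn⟩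
  by_cases hpos : 0 < height w w.length
  · obtain ⟨u, h1, h2, h3, h4, h5⟩ := exists_open (l := l) hpos
    rw [h5, List.headD_cons]
    have hu : IsUnpaired w u := ⟨h2, h4⟩
    have hbox : ∀ j < l u, box w u j ∈ skewShape w mu := by
      intro j hj
      obtain ⟨a, b, hr, g1, g2⟩ := h.exists_run_of_lt hj
      exact (box_mem_skewShape hm).2 ⟨by have := hr.pos; omega, h1.le,
        hj.trans_le (h.left u h1)⟩
    have hpart : ∀ j < l u, ∃ a, a ≤ u ∧ IsRun w m l a w.length j ∧
        T.part (box w u j) = row w a w.length j := by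
      intro j hj
      obtain ⟨a, b, hr, g1, g2⟩ := h.exists_run_of_lt hj
      obtain rfl : b = w.length := by
        refine le_antisymm hr.le_length ?_
        by_contra hbL
        have := hu.le_link hL hb g2.le (by omega)
        have := hr.stops
        omega
      refine ⟨a, g1, hr, T.part_eq_of_mem ?_ (box_mem_row.2 ⟨rfl, g1, g2.le⟩)⟩
      rw [hp, mem_partsOf_iff h]
      exact ⟨a, _, j, hr, rfl⟩
    rw [← Finset.card_range (l u)]
    symm
    refine Finset.card_bij (fun j _ => T.part (box w u j)) ?_ ?_ ?_
    · intro j hj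
      rw [Finset.mem_range] at hj
      obtain ⟨a, g1, hr, g2⟩ := hpart j hj
      rw [Finset.mem_filter]
      refine ⟨T.part_mem.2 (hbox j hj), ?_⟩
      rw [g2]
      rintro ⟨n, hn⟩
      obtain ⟨-, k2, -⟩ := (isTile_row_iff hr.le hr.le_length).1 hn
      have := (hL.runsOK hb a _ j hr).1 u g1 h1.le
      push_cast at k2
      omega
    · intro j hj j' hj' he
      rw [Finset.mem_range] at hj hj'
      obtain ⟨a, g1, hr, g2⟩ := hpart j hj
      obtain ⟨a', g1', hr', g2'⟩ := hpart j' hj'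
      rw [g2, g2'] at he
      exact (row_inj hr.le he).2.2
    · intro t ht
      rw [Finset.mem_filter] at ht
      obtain ⟨a, b, j, n, n', hr, rfl, hn', hn⟩ := hrun t ht.1 ht.2
      obtain ⟨rfl, u', g1, g2, g3, g4⟩ := exists_unpaired_of_run hL hb hr hn hn'
      have hau : a ≤ u := by
        by_contra hau
        have := h4 a (by omega) hr.le
        omega
      refine ⟨j, Finset.mem_range.2 (hr.link u hau h1), ?_⟩
      exact T.part_eq_of_mem ht.1 (box_mem_row.2 ⟨rfl, hau, h1.le⟩)
  · rw [stk_eq_nil hb hpos, List.headD_nil, Finset.card_eq_zero, Finset.filter_eq_empty_iff]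
    intro t ht hnd
    obtain ⟨a, b, j, n, n', hr, rfl, hn', hn⟩ := hrun t ht hnd
    obtain ⟨rfl, u', g1, g2, g3, g4⟩ := exists_unpaired_of_run hL hb hr hn hn'
    have := isBallot_iff.1 hb u'
    omega

/-- A tile has `2n + n' + 1` boxes, with `n'` zero or odd, so the truncated division in `tileArt` is
exact. -/
theorem two_mul_tileArt {T : Finpartition (skewShape w mu)} (hT : IsTilingBI w mu T)
    (h : LinkBounds w m l) (hp : T.parts = partsOf w m l) {t : Finset (ℕ × ℤ)}
    (ht : t ∈ T.parts) [Decidable (∃ n, IsTile n 0 t)] :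
    2 * tileArt t = t.card + if ∃ n, IsTile n 0 t then 1 else 0 := by
  have key : Even (t.card + if ∃ n, IsTile n 0 t then 1 else 0) := by
    obtain ⟨n, n', hn⟩ := hT.tile t ht
    have ht' := ht
    rw [hp, mem_partsOf_iff h] at ht'
    obtain ⟨a, b, j, hr, rfl⟩ := ht'
    obtain ⟨k1, k2, k3⟩ := (isTile_row_iff hr.le hr.le_length).1 hn
    have hc : (row w a b j).card = 2 * n + n' + 1 := by
      rw [card_row]
      omega
    rw [hc]
    split_ifs with hd
    · obtain ⟨n2, hn2⟩ := hd
      obtain ⟨-, k4, -⟩ := (isTile_row_iff hr.le hr.le_length).1 hn2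
      push_cast at k4
      rw [Nat.even_iff]
      omega
    · have hn' : 0 < n' := by
        refine Nat.pos_of_ne_zero ?_
        rintro rfl
        exact hd ⟨n, hn⟩
      have : ¬ Even n' := fun he => hT.none_of_even n n' he hn' _ ht hn
      rw [Nat.even_iff] at this ⊢
      omega
  have := Nat.two_mul_div_two_of_even key
  rw [← this, tileArt]
  congr!

/-- A down step has the link number that it removes from the stack, so the surplus of the up steps
is the sum over the steps still open. -/
theorem sum_up_eq (hL : LinkOK w l) {p : ℕ} (hp : p ≤ w.length) :
    ∑ x ∈ Finset.range p, (if w[x]? = some DyckStep.U then l x else 0) =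
      ∑ x ∈ Finset.range p, (if w[x]? = some DyckStep.U then 0 else l x) + (stk w l p).sum := by
  induction p with
  | zero => simp [stk]
  | succ p ih =>
    rw [Finset.sum_range_succ, Finset.sum_range_succ, ih (by omega)]
    rcases step_cases (w := w) (x := p) (by omega) with hw | hw
    · rw [stk_up hw, hw]
      simp
      ring
    · rw [stk_down hw, hw, hL.down p hw]
      rcases stk w l p with _ | ⟨c, t⟩ <;> simp
      ring

/-- After the first entry the list consists of equal pairs, a missing partner being `0`, and
`endExp` takes one entry of each pair. -/
theorem sum_eq_of_endOK {st : List ℕ} (h : EndOK st) : st.sum = 2 * endExp st + st.headD 0 := by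
  induction st using EndOK.induct with
  | case1 => rfl
  | case2 a => simp [endExp]
  | case3 a b st ih =>
    rw [EndOK] at h
    rw [List.sum_cons, List.sum_cons, ih h.2.2, endExp, ← h.2.1, List.headD_cons]
    ring

/-- Twice `art` is the area plus the number of Dyck tiles. There are `∑ m - ∑ l` tiles, and those
that are not Dyck are counted by the top of the final stack. Eliminating the link numbers of the
down steps makes this top cancel and leaves an even expression. -/
theorem art_eq_cfgStat {T : Finpartition (skewShape w mu)} (hT : IsTilingBI w mu T)
    (hm : ∀ x ≤ w.length, height mu x = height w x + 2 * (m x : ℤ))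
    (hb : IsBallot w) (h : LinkBounds w m l) (hp : T.parts = partsOf w m l) (hL : LinkOK w l)
    (hE : EndOK (stk w l w.length)) : art T = cfgStat w m l := by
  classical
  have h1 : 2 * art T = (skewShape w mu).card + (T.parts.filter fun t => ∃ n, IsTile n 0 t).card := by
    rw [art, Finset.mul_sum, ← T.sum_card_parts, Finset.card_filter, ← Finset.sum_add_distrib]
    exact Finset.sum_congr rfl fun t ht => two_mul_tileArt hT h hp ht
  have h2 := Finset.card_filter_add_card_filter_not (s := T.parts) (fun t => ∃ n, IsTile n 0 t)
  rw [card_filter_not_dyck hT hm hb h hp hL] at h2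
  have h3 : T.parts.card + ∑ x ∈ Finset.range w.length, l x =
      ∑ x ∈ Finset.range w.length, m (x + 1) := by
    have e : Finset.Icc 1 w.length = Finset.Ico (0 + 1) (w.length + 1) := by
      ext
      simp
    rw [hp, card_partsOf, e, ← Finset.sum_Ico_add' (fun x => m x - l (x - 1)), ← Finset.range_eq_Ico,
      ← Finset.sum_add_distrib]
    refine Finset.sum_congr rfl fun x hx => ?_
    have := h.right x (Finset.mem_range.1 hx)
    rw [Nat.add_sub_cancel]
    omega
  have h4 : (skewShape w mu).card = ∑ x ∈ Finset.range w.length, m (x + 1) := by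
    have e : Finset.Icc 1 w.length = Finset.Ico (0 + 1) (w.length + 1) := by
      ext
      simp
    rw [card_skewShape hm, e, ← Finset.sum_Ico_add' m, ← Finset.range_eq_Ico]
  have h5 := sum_up_eq hL le_rfl
  rw [sum_eq_of_endOK hE] at h5
  have h6 : ∑ x ∈ Finset.range w.length, l x =
      ∑ x ∈ Finset.range w.length, (if w[x]? = some DyckStep.U then l x else 0) +
      ∑ x ∈ Finset.range w.length, (if w[x]? = some DyckStep.U then 0 else l x) := by
    rw [← Finset.sum_add_distrib]
    refine Finset.sum_congr rfl fun x _ => ?_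
    split_ifs <;> simp
  have h7 : ∑ x ∈ Finset.range w.length,
      (if w[x]? = some DyckStep.U then m (x + 1) - l x else m (x + 1)) +
      ∑ x ∈ Finset.range w.length, (if w[x]? = some DyckStep.U then l x else 0) =
      ∑ x ∈ Finset.range w.length, m (x + 1) := by
    rw [← Finset.sum_add_distrib]
    refine Finset.sum_congr rfl fun x hx => ?_
    have := h.right x (Finset.mem_range.1 hx)
    split_ifs <;> omega
  rw [cfgStat]
  omega

end Art

/-! ### Paths above a path -/

theorem height_emod (w : List DyckStep) {x : ℕ} (hx : x ≤ w.length) : height w x % 2 = (x : ℤ) % 2 := by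
  induction x with
  | zero => simp [height_zero]
  | succ x ih =>
    have := ih (by omega)
    rcases step_cases (w := w) (x := x) (by omega) with hw | hw
    · have := height_up hw
      omega
    · have := height_down hw
      omega

theorem eq_of_height_eq {w w' : List DyckStep} (hl : w.length = w'.length)
    (h : ∀ x ≤ w.length, height w x = height w' x) : w = w' := by
  refine List.ext_getElem? fun x => ?_
  rcases Nat.lt_or_ge x w.length with hx | hx
  · have h1 := h x hx.le
    have h2 := h (x + 1) hx
    rcases step_cases hx with hw | hw <;>
      rcases step_cases (w := w') (x := x) (by omega) with hw' | hw' <;> rw [hw, hw']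
    · have := height_up hw
      have := height_down hw'
      omega
    · have := height_down hw
      have := height_up hw'
      omega
  · rw [List.getElem?_eq_none hx, List.getElem?_eq_none (by omega)]

theorem mem_words {n : ℕ} {w : List DyckStep} : w ∈ words n ↔ w.length = n := by
  induction n generalizing w with
  | zero => simp [words]
  | succ n ih =>
    rw [words, Finset.mem_union, Finset.mem_image, Finset.mem_image]
    constructor
    · rintro (⟨v, hv, rfl⟩ | ⟨v, hv, rfl⟩) <;> simp [ih.1 hv]
    · intro h
      rcases w with _ | ⟨_ | _, w⟩
      · simp at h
      · exact Or.inl ⟨w, ih.2 (by simpa using h), rfl⟩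
      · exact Or.inr ⟨w, ih.2 (by simpa using h), rfl⟩

theorem mem_upperPaths {w mu : List DyckStep} :
    mu ∈ upperPaths w ↔ mu.length = w.length ∧ IsBallot mu ∧ IsAbove mu w := by
  simp only [upperPaths, Finset.mem_filter, mem_words]

/-- The number of boxes between `w` and `mu` in a column. -/
noncomputable def colOf (w mu : List DyckStep) (x : ℕ) : ℕ :=
  if x ≤ w.length then ((height mu x - height w x) / 2).toNat else 0

theorem height_eq_colOf {w mu : List DyckStep} (h : mu ∈ upperPaths w) :
    ∀ x ≤ w.length, height mu x = height w x + 2 * (colOf w mu x : ℤ) := by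
  intro x hx
  obtain ⟨h1, h2, h3⟩ := mem_upperPaths.1 h
  have e1 := height_emod w hx
  have e2 := height_emod mu (x := x) (by omega)
  have := h3 x
  rw [colOf, if_pos hx]
  omega

theorem colOK_of_height {w mu : List DyckStep} {m : ℕ → ℕ} (hl : mu.length = w.length)
    (hm : ∀ x ≤ w.length, height mu x = height w x + 2 * (m x : ℤ)) : ColOK w m := by
  refine ⟨?_, fun x hx => ?_, fun x hx => ?_⟩
  · have := hm 0 (Nat.zero_le _)
    rw [height_zero, height_zero] at this
    omega
  all_goals
    have hxl := lt_length_of_getElem? hx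
    have h1 := hm x hxl.le
    have h2 := hm (x + 1) hxl
    first | have h3 := height_up hx | have h3 := height_down hx
    rcases step_cases (w := mu) (x := x) (by omega) with hw | hw
    · have := height_up hw
      omega
    · have := height_down hw
      omega

/-- A path with given numbers of boxes between it and a ballot path. -/
theorem exists_upperPath {w : List DyckStep} {m : ℕ → ℕ} (hb : IsBallot w) (hm : ColOK w m) :
    ∃ mu ∈ upperPaths w, ∀ x ≤ w.length, height mu x = height w x + 2 * (m x : ℤ) := by
  set mu : List DyckStep := (List.range w.length).map fun x =>
    if height w (x + 1) + 2 * (m (x + 1) : ℤ) = height w x + 2 * (m x : ℤ) + 1 then DyckStep.U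
    else DyckStep.D with hmu
  have hlen : mu.length = w.length := by simp [hmu]
  have hget : ∀ x < w.length, mu[x]? = some
      (if height w (x + 1) + 2 * (m (x + 1) : ℤ) = height w x + 2 * (m x : ℤ) + 1 then DyckStep.U
      else DyckStep.D) := by
    intro x hx
    simp [hmu, List.getElem?_range hx]
  have hh : ∀ x ≤ w.length, height mu x = height w x + 2 * (m x : ℤ) := by
    intro x
    induction x with
    | zero =>
      intro _
      rw [height_zero, height_zero, hm.zero]
      rfl
    | succ x ih =>
      intro hx
      have ih := ih (by omega)
      have hg := hget x (by omega)
      split_ifs at hg with hc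
      · rw [height_up hg]
        omega
      · rw [height_down hg]
        rcases step_cases (w := w) (x := x) (by omega) with hw | hw
        · have := height_up hw
          have := hm.up x hw
          omega
        · have := height_down hw
          have := hm.down x hw
          omega
  have habove : IsAbove mu w := by
    intro x
    rcases le_total x w.length with hx | hx
    · rw [hh x hx]
      omega
    · rw [height_of_length_le hx, height_of_length_le (w := mu) (by omega), hlen, hh _ le_rfl]
      omega
  refine ⟨mu, mem_upperPaths.2 ⟨hlen, ?_, habove⟩, hh⟩
  rw [isBallot_iff]
  exact fun x => (isBallot_iff.1 hb x).trans (habove x)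

theorem CfgOK.mem_le_col {w : List DyckStep} {m l : ℕ → ℕ} (h : CfgOK w m l) (p : ℕ) :
    p ≤ w.length → ∀ c ∈ stk w l p, c ≤ m p := by
  induction p with
  | zero => simp [stk]
  | succ p ih =>
    intro hp c hc
    have ih := ih (by omega)
    rcases step_cases (w := w) (x := p) (by omega) with hw | hw
    · exact (h.link.le_of_mem_succ (by omega) hc).trans (h.le p hw)
    · rw [stk_down hw] at hc
      exact (ih c (List.mem_of_mem_tail hc)).trans (h.col.down p hw).1

theorem CfgOK.linkBounds {w : List DyckStep} {m l : ℕ → ℕ} (h : CfgOK w m l)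
    (hl : ∀ x, w.length ≤ x → l x = 0) : LinkBounds w m l := by
  have key : ∀ x < w.length, l x ≤ m x ∧ l x ≤ m (x + 1) := by
    intro x hx
    rcases step_cases hx with hw | hw
    · exact ⟨(h.le x hw).trans (h.col.up x hw).2, h.le x hw⟩
    · have : l x ≤ m x := by
        rw [h.link.down x hw]
        rcases hs : stk w l x with _ | ⟨c, t⟩
        · exact Nat.zero_le _
        · exact h.mem_le_col x hx.le c (by rw [hs]; simp)
      exact ⟨this, this.trans (h.col.down x hw).1⟩
  refine ⟨?_, fun x hx => (key x hx).1, fun x hx => (key x hx).2, hl⟩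
  rcases Nat.eq_zero_or_pos w.length with h0 | h0
  · exact hl 0 (by omega)
  · have := (key 0 h0).1
    rw [h.col.zero] at this
    omega

/-! ### Words without arrows -/

/-- The recursion of `ballotTree` reaches the pair closed by this `D` with `U b` as the rest of the
word. The arrow of its edge tests the parity of the number of unpaired up steps in `U b`, which is
one more than in `b`. -/
theorem noArrow_append {w : List DyckStep} (hb : IsBallot w) (hT : (ballotTree w).NoArrows)
    {a b : List DyckStep} (hw : w = a ++ DyckStep.D :: DyckStep.U :: b) (hbb : IsBallot b) :
    ¬ Even (unpairedU b) := by
  induction hn : w.length using Nat.strong_induction_on generalizing w a with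
  | _ n ih =>
  rcases w with _ | ⟨s, w⟩
  · simp at hw
  rcases s
  · rcases a with _ | ⟨s, a⟩
    · simp at hw
    simp only [List.cons_append, List.cons.injEq] at hw
    obtain ⟨rfl, hw⟩ := hw
    simp at hn
    rcases h : splitAtPartner 0 w with _ | ⟨z, w'⟩
    · have hb' := isBallot_of_splitAtPartner_none h
      rw [ballotTree_up_none h] at hT
      refine ih w.length (by omega) hb' ?_ hw rfl
      split_ifs at hT
      · exact hT.2.1
      · exact hT
    · obtain ⟨rfl, h1, h2, h3, h4⟩ := splitAtPartner_parts h hb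
      rw [ballotTree_up_some h] at hT
      simp at hn
      have first : w' = DyckStep.U :: b → ¬ Even (unpairedU b) := by
        rintro rfl
        have := of_decide_eq_false hT.1
        have hle := isBallot_count_le hbb
        have e : unpairedU (DyckStep.U :: b) = unpairedU b + 1 := by
          simp [unpairedU]
          omega
        rw [e, Nat.odd_add_one, not_not] at this
        exact Nat.not_even_iff_odd.2 this
      rcases List.append_eq_append_iff.1 hw with ⟨c, hc1, hc2⟩ | ⟨c, hc1, hc2⟩
      · rcases c with _ | ⟨s, c⟩
        · simp only [List.nil_append, List.cons.injEq, true_and] at hc2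
          exact first hc2
        · simp only [List.cons_append, List.cons.injEq] at hc2
          obtain ⟨rfl, hc2⟩ := hc2
          exact ih w'.length (by omega) h3 hT.2.2 hc2 rfl
      · rcases c with _ | ⟨s, _ | ⟨s', c⟩⟩
        · simp only [List.nil_append, List.cons.injEq, true_and] at hc2
          exact first hc2.symm
        · simp at hc2
        -- Here the `U` lies inside the Dyck word `z`, so it is paired there and what follows it
        -- cannot be a ballot path.
        · exfalso
          simp only [List.cons_append, List.cons.injEq] at hc2
          obtain ⟨rfl, rfl, rfl⟩ := hc2
          have k1 := hbb (c.length + 1)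
          have k2 := h1 (a.length + 1)
          rw [hc1] at h2 k2
          rw [List.take_length_add_append] at k1 k2
          simp at h2 k1 k2
          omega
  · have := hb 1
    simp at this

theorem noArrowWord {w : List DyckStep} (hb : IsBallot w) (hT : (ballotTree w).NoArrows) :
    NoArrowWord w := by
  intro u hu ho
  have hul := hu.lt_length
  rcases step_cases (w := w) (x := u) (by omega) with hw | hw
  · exact hw
  exfalso
  have e1 : w.drop (u + 1) = DyckStep.U :: w.drop (u + 2) := by
    rw [List.drop_eq_getElem_cons hul]
    congr 1
    have := hu.1
    rwa [List.getElem?_eq_getElem hul, Option.some_inj] at this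
  have e2 : w.drop u = DyckStep.D :: w.drop (u + 1) := by
    have hul' : u < w.length := by omega
    rw [List.drop_eq_getElem_cons hul']
    congr 1
    rwa [List.getElem?_eq_getElem hul', Option.some_inj] at hw
  have hh : ∀ x, height (w.drop (u + 2)) x = height w (u + 2 + x) - height w (u + 2) := by
    intro x
    have := height_take_drop (w := w) (a := u + 2) (k := w.length + x) (i := x) (by omega)
    rwa [List.take_of_length_le (by simp; omega)] at this
  have hup : height w (u + 2) = height w (u + 1) + 1 := height_up hu.1
  have hbb : IsBallot (w.drop (u + 2)) := by
    rw [isBallot_iff]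
    intro x
    rw [hh]
    rcases le_total (u + 2 + x) w.length with hx | hx
    · have := hu.2 (u + 2 + x) (by omega) hx
      omega
    · rw [height_of_length_le hx]
      have := hu.2 w.length (by omega) le_rfl
      omega
  refine noArrow_append hb hT (a := w.take u) (b := w.drop (u + 2)) ?_ hbb ?_
  · rw [← e1, ← e2, List.take_append_drop]
  · have h1 := height_length (w.drop (u + 2))
    rw [hh, height_of_length_le (x := u + 2 + _) (by simp; omega)] at h1
    have := isBallot_count_le hbb
    rw [unpairedU, Nat.even_iff]
    rw [Int.odd_iff] at ho
    omega

/-! ### The main theorem -/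

theorem hookProd_ne_zero (t : MarkedTree) : hookProd t ≠ 0 := by
  induction t with
  | root => simp [hookProd, MarkedTree.hookLengths]
  | edge dot arrow below right ih1 ih2 =>
    have : qInt (if dot then 2 * below.size + 2 else below.size + 1) ≠ 0 :=
      qInt_ne_zero (by split_ifs <;> omega)
    rw [hookProd] at ih1 ih2
    simp only [hookProd, MarkedTree.hookLengths, List.map_cons, List.map_append, List.prod_cons,
      List.prod_append]
    exact mul_ne_zero this (mul_ne_zero ih1 ih2)

/-- The bijection sends `(mu, T)` to the list whose entry at `x` is the link number of step `x`
together with the number of boxes in column `x + 1`. Heights recover `mu`, and runs recover `T`. -/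
theorem genFunBILower_eq_gf {w : List DyckStep} (hb : IsBallot w)
    (hT : (ballotTree w).NoArrows) : genFunBILower w = gf w [] 0 := by
  classical
  have hN := noArrowWord hb hT
  simp only [genFunBILower, genFunBI, gf]
  rw [Finset.sum_sigma']
  have hf : ∀ mu (T : Finpartition (skewShape w mu)), mu ∈ upperPaths w → IsTilingBI w mu T →
      lnk ((List.range w.length).map fun x => (lnkT w T x, colOf w mu (x + 1))) = lnkT w T ∧
      col ((List.range w.length).map fun x => (lnkT w T x, colOf w mu (x + 1))) = colOf w mu := by
    intro mu T hmu hT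
    have hm := height_eq_colOf hmu
    have h := linkBounds_lnkT hm hT
    constructor
    · funext x
      rcases Nat.lt_or_ge x w.length with hx | hx
      · simp [lnk, hx]
      · rw [h.length x hx]
        simp [lnk, hx]
    · funext x
      rcases x with _ | x
      · rw [(colOK_of_height (mem_upperPaths.1 hmu).1 hm).zero]
        rfl
      · rcases Nat.lt_or_ge x w.length with hx | hx
        · simp [col, hx]
        · rw [colOf, if_neg (by omega)]
          simp [col, hx]
  refine Finset.sum_bij (fun s _ => (List.range w.length).map fun x =>
    (lnkT w s.2 x, colOf w s.1 (x + 1))) ?_ ?_ ?_ ?_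
  · rintro ⟨mu, T⟩ hs
    simp only [Finset.mem_sigma, Finset.mem_filter, Finset.mem_univ, true_and] at hs
    obtain ⟨hmu, hT⟩ := hs
    have hm := height_eq_colOf hmu
    have h := linkBounds_lnkT hm hT
    have hp := parts_eq_partsOf hm hT
    obtain ⟨e1, e2⟩ := hf mu T hmu hT
    rw [mem_cfgs_iff, e1, e2]
    refine ⟨by simp, colOK_of_height (mem_upperPaths.1 hmu).1 hm,
      (RunsOK.of_tiling hT h hp).linkOK hb h, fun x hx => h.right x (lt_length_of_getElem? hx),
      endOK_of_tiling hT hb hN h hp⟩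
  · rintro ⟨mu, T⟩ hs ⟨mu', T'⟩ hs' he
    simp only [Finset.mem_sigma, Finset.mem_filter, Finset.mem_univ, true_and] at hs hs'
    obtain ⟨hmu, hT⟩ := hs
    obtain ⟨hmu', hT'⟩ := hs'
    dsimp only at he
    obtain ⟨e1, e2⟩ := hf mu T hmu hT
    obtain ⟨e1', e2'⟩ := hf mu' T' hmu' hT'
    rw [he, e1'] at e1
    rw [he, e2'] at e2
    have hm := height_eq_colOf hmu
    have hm' := height_eq_colOf hmu'
    have hl := (mem_upperPaths.1 hmu).1
    obtain rfl : mu = mu' := by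
      refine eq_of_height_eq (hl.trans (mem_upperPaths.1 hmu').1.symm) fun x hx => ?_
      rw [hm x (by omega), hm' x (by omega), e2]
    obtain rfl : T = T' := by
      refine Finpartition.ext ?_
      rw [parts_eq_partsOf hm hT, parts_eq_partsOf hm hT', e1]
    rfl
  · intro p hp
    obtain ⟨hlen, hc⟩ := mem_cfgs_iff.1 hp
    obtain ⟨mu, hmu, hm⟩ := exists_upperPath hb hc.col
    -- Past the end of the list `lnk` takes its default value `0`, so no run continues beyond the
    -- last column.
    have h : LinkBounds w (col p) (lnk p) := hc.linkBounds fun x hx => by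
      simp [lnk, List.getElem?_eq_none (hlen.trans_le hx)]
    obtain ⟨T, hT⟩ := h.exists_finpartition hm
    have hBI := isTilingBI_of_cfg hb hN h hT hc.link hc.endOK
    refine ⟨⟨mu, T⟩, by simp [hmu, hBI], ?_⟩
    have e1 : lnkT w T = lnk p := lnkT_eq (lt_iff_linked h hT)
    have e2 : ∀ x ≤ w.length, colOf w mu x = col p x := fun x hx => by
      have h1 := hm x hx
      have h2 := height_eq_colOf hmu x hx
      omega
    refine List.ext_getElem (by simp [hlen]) fun x h1 h2 => ?_
    have hx : x < w.length := by simpa using h1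
    simp [e1, e2 (x + 1) hx, lnk, col, h2]
  · rintro ⟨mu, T⟩ hs
    simp only [Finset.mem_sigma, Finset.mem_filter, Finset.mem_univ, true_and] at hs
    obtain ⟨hmu, hT⟩ := hs
    have hm := height_eq_colOf hmu
    have h := linkBounds_lnkT hm hT
    have hp := parts_eq_partsOf hm hT
    obtain ⟨e1, e2⟩ := hf mu T hmu hT
    rw [wt_eq_cfgStat (by simp), e1, e2, art_eq_cfgStat hT hm hb h hp
      ((RunsOK.of_tiling hT h hp).linkOK hb h) (endOK_of_tiling hT hb hN h hp)]

end BallotBI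

theorem mainTheorem9 (lam : List DyckStep) (hlam : BallotBI.IsBallot lam)
    (hT : (BallotBI.ballotTree lam).NoArrows) :
    algebraMap (Polynomial ℤ) (RatFunc ℤ) (BallotBI.genFunBILower lam) =
      algebraMap (Polynomial ℤ) (RatFunc ℤ)
          (BallotBI.qEvenDoubleFactorial (BallotBI.ballotTree lam).size) /
        ((BallotBI.ballotTree lam).hookLengths.map fun l =>
          algebraMap (Polynomial ℤ) (RatFunc ℤ) (BallotBI.qInt l)).prod := by
  have hprod : ((BallotBI.ballotTree lam).hookLengths.map fun l =>
      algebraMap (Polynomial ℤ) (RatFunc ℤ) (BallotBI.qInt l)).prod =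
      algebraMap (Polynomial ℤ) (RatFunc ℤ) (BallotBI.hookProd (BallotBI.ballotTree lam)) := by
    rw [BallotBI.hookProd, map_list_prod, List.map_map]
    rfl
  rw [hprod, ← BallotBI.hookProd_mul_gf lam hlam hT, BallotBI.genFunBILower_eq_gf hlam hT, map_mul,
    mul_div_cancel_left₀]
  exact (map_ne_zero_iff _ (RatFunc.algebraMap_injective ℤ)).2 (BallotBI.hookProd_ne_zero _)
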